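/- Let $Y$ be a real Hilbert space with Riesz map $R\colon Y\to Y^\star$, let $U$ be a real Banach space, and let $A\colon Y\times U\to Y^\star$, $B\colon Y\times U\rightrightarrows Y^\star$ and $\Phi\colon Y\times U\to Y$. Let $(y^*,u^*)\in Y\times U$ satisfy $$0\in A(y^*,u^*)+B(y^*-\Phi(y^*,u^*),u^*),$$ let $\mathcal U\subset U$ be a neighborhood of $u^*$, let $\varepsilon,\mu_A,L_A>0$ and $L_\Phi\in[0,1)$, and let $B_\varepsilon(y^*)$ and $U_\varepsilon(y^*)$ denote the closed and the open ball in $Y$ with center $y^*$ and radius $\varepsilon$. Assume the following. 1. For all $u\in\mathcal U$ and $y_1,y_2\in B_\varepsilon(y^*)$, $$\langle A(y_2,u)-A(y_1,u),y_2-y_1\rangle\ge\mu_A\|y_2-y_1\|^2,\qquad \|A(y_2,u)-A(y_1,u)\|\le L_A\|y_2-y_1\|,\qquad \|\Phi(y_2,u)-\Phi(y_1,u)\|\le L_\Phi\|y_2-y_1\|.$$ 2. $B(\cdot,u)$ is maximally monotone for all $u\in\mathcal U$; $J_B\colon Y\times\mathcal U\to Y$ denotes its resolvent, i.e. $y=J_B(q,u)$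 is the unique solution of $0\in R(y-q)+B(y,u)$. 3. $\Phi$ is continuous at $(y^*,u^*)$. 4. With $\gamma_A=L_A/\mu_A$, either (a) $L_\Phi<\gamma_A^{-1}$, or (b) $L_\Phi<2\sqrt{\gamma_A}/(1+\gamma_A)$ and there is a function $g\colon U_\varepsilon(y^*)\times\mathcal U\to\mathbb R$ such that $A$ is the Fréchet derivative of $g$ with respect to the first variable on $U_\varepsilon(y^*)\times\mathcal U$. 5. $A$ and $\Phi$ are directionally differentiable at $(y^*,u^*)$, and $J_B$ is directionally differentiable at $(q^*-\Phi(y^*,u^*),u^*)$, where $q^*=y^*-R^{-1}A(y^*,u^*)$. Here $F$ is directionally differentiable at $x$ if $F'(x;v)=\lim_{t\searrow0}(F(x+tv)-F(x))/t$ exists (in norm) for every direction $v$. Then for each $h\in U$ there exists $t_0>0$ such that for all $t\in[0,t_0]$ the problem $$0\in A(y_t,u^*+th)+B(y_t-\Phi(y_t,u^*+th),u^*+th)$$ has a unique solution $y_t$ in $B_\varepsilon(y^*)$. Moreover, $(y_t-y^*)/t\to\delta$ in $Y$ as $t\searrow0$, where $\delta\in Y$ is the unique solution of $$0\in A'(y^*,u^*;\delta,h)+DB\bigl(y^*-\Phi(y^*,u^*),u^*\,\big|\,\xi^*\bigr)\bigl(\delta-\Phi'(y^*,u^*;\delta,h),h\bigr),\qquad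 \xi^*=-A(y^*,u^*).$$ Here, for $\xi\in B(y,u)$ such that $J_B$ is directionally differentiable at $(y+R^{-1}\xi,u)$, $$DB(y,u\,|\,\xi)(d,h):=\{R(k-d) : k\in Y,\ d=J_B'(y+R^{-1}\xi,u;k,h)\}.$$ -/

import Mathlib

open Set Filter Topology Metric
open scoped Pointwise

noncomputable section

/-- A set-valued map from a Hilbert space `Y` to its dual is monotone if
`⟨ξ₂ - ξ₁, y₂ - y₁⟩ ≥ 0` for all pairs `(y₁, ξ₁)`, `(y₂, ξ₂)` in its graph. -/
def IsMonotoneOperator {Y : Type*} [NormedAddCommGroup Y] [InnerProductSpace ℝ Y]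
    (T : Y → Set (StrongDual ℝ Y)) : Prop :=
  ∀ y₁ y₂ : Y, ∀ ξ₁ ∈ T y₁, ∀ ξ₂ ∈ T y₂, 0 ≤ (ξ₂ - ξ₁) (y₂ - y₁)

/-- A monotone set-valued map is maximally monotone if its graph is not properly contained in the
graph of another monotone map (set-valued maps are ordered by pointwise inclusion). -/
def IsMaximallyMonotone {Y : Type*} [NormedAddCommGroup Y] [InnerProductSpace ℝ Y]
    (T : Y → Set (StrongDual ℝ Y)) : Prop :=
  Maximal IsMonotoneOperator T

/-- The Riesz map `R : Y → Y⋆`. -/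
abbrev riesz (Y : Type*) [NormedAddCommGroup Y] [InnerProductSpace ℝ Y] [CompleteSpace Y] :
    Y ≃ₗᵢ⋆[ℝ] StrongDual ℝ Y :=
  InnerProductSpace.toDual ℝ Y

open Classical in
/-- The resolvent `J_B : (q, u) ↦ y` of a parametrized operator `B : Y × U ⇉ Y⋆`, i.e. the
solution `y` of `0 ∈ R (y - q) + B (y, u)`. If `B (·, u)` is maximally monotone, there is exactly
one such `y`; the value `0` is used only where there is no solution. -/
def resolventMap {Y U : Type*} [NormedAddCommGroup Y] [InnerProductSpace ℝ Y] [CompleteSpace Y]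
    (B : Y × U → Set (StrongDual ℝ Y)) (p : Y × U) : Y :=
  if hp : ∃ y : Y, 0 ∈ {riesz Y (y - p.1)} + B (y, p.2) then hp.choose else 0

/-- `F` is directionally differentiable at `x`: for every direction `v` the one-sided limit of
`(F (x + t v) - F x) / t` as `t ↘ 0` exists. -/
def DirDifferentiableAt {X E : Type*} [NormedAddCommGroup X] [NormedSpace ℝ X]
    [NormedAddCommGroup E] [NormedSpace ℝ E] (F : X → E) (x : X) : Prop :=
  ∀ v : X, DifferentiableWithinAt ℝ (fun t : ℝ => F (x + t • v)) (Ici 0) 0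

/-- The (one-sided) directional derivative `F'(x; v) = lim_{t ↘ 0} (F (x + t v) - F x) / t`. -/
def dirDeriv {X E : Type*} [NormedAddCommGroup X] [NormedSpace ℝ X]
    [NormedAddCommGroup E] [NormedSpace ℝ E] (F : X → E) (x v : X) : E :=
  derivWithin (fun t : ℝ => F (x + t • v)) (Ici 0) 0

/-- The linearization `DB(y, u | ξ) : Y × U ⇉ Y⋆` of `B` at `(y, u)` for `ξ ∈ B (y, u)`:
`DB(y, u | ξ)(δ, h) = {R (k - δ) | k ∈ Y, δ = J_B'(q, u; k, h)}` with `q = y + R⁻¹ ξ`. -/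
def linearizedOperator {Y U : Type*} [NormedAddCommGroup Y] [InnerProductSpace ℝ Y]
    [CompleteSpace Y] [NormedAddCommGroup U] [NormedSpace ℝ U]
    (B : Y × U → Set (StrongDual ℝ Y)) (y : Y) (u : U) (ξ : StrongDual ℝ Y) (p : Y × U) :
    Set (StrongDual ℝ Y) :=
  {η | ∃ k : Y, p.1 = dirDeriv (resolventMap B) (y + (riesz Y).symm ξ, u) (k, p.2) ∧
    η = riesz Y (k - p.1)}

/-- `y` solves the quasi-generalized equation `0 ∈ A(y, u) + B(y - Φ(y, u), u)`. -/
def SolvesQGE {Y U : Type*} [NormedAddCommGroup Y] [InnerProductSpace ℝ Y]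
    (A : Y × U → StrongDual ℝ Y) (B : Y × U → Set (StrongDual ℝ Y)) (Φ : Y × U → Y)
    (u : U) (y : Y) : Prop :=
  0 ∈ {A (y, u)} + B (y - Φ (y, u), u)

/-- `δ` solves the linearized equation
`0 ∈ A'(y, u; δ, h) + DB(y - Φ(y, u), u | ξ)(δ - Φ'(y, u; δ, h), h)` with `ξ = -A(y, u)`. -/
def SolvesLinearizedQGE {Y U : Type*} [NormedAddCommGroup Y] [InnerProductSpace ℝ Y]
    [CompleteSpace Y] [NormedAddCommGroup U] [NormedSpace ℝ U]
    (A : Y × U → StrongDual ℝ Y) (B : Y × U → Set (StrongDual ℝ Y)) (Φ : Y × U → Y)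
    (y : Y) (u h : U) (δ : Y) : Prop :=
  0 ∈ {dirDeriv A (y, u) (δ, h)} +
    linearizedOperator B (y - Φ (y, u)) u (-A (y, u)) (δ - dirDeriv Φ (y, u) (δ, h), h)

end

/-!
Through the Riesz map the problem becomes: find `y` with `(y - φ y, -a y) ∈ M`, where
`a = R⁻¹ A(·, u)` and `M ⊆ Y × Y` is a maximally monotone graph.

The smallness condition on `LΦ` is used exactly once, to show
`⟪a y - a x, (y - φ y) - (x - φ x)⟫ ≥ c ‖y - x‖²` on the ball with some `c > 0`, i.e. that `a` is
strongly monotone in the variable `z = y - φ y` (`SplitBounds`). Without a potential this is the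
Cauchy–Schwarz inequality. If `a` is a gradient, it follows from the inequality
`‖Δa‖² + μ L ‖Δy‖² ≤ (L + μ) ⟪Δa, Δy⟫` by completing the square. That inequality is the
Baillon–Haddad theorem for `g - μ ‖·‖² / 2`; as `a` is a gradient on a ball only, it is proved on
short pieces of the segment between the two points and summed (`gradient_cocoercive_ball`).

Two consequences of these bounds carry the rest. First, a point with small residual has a solution
nearby (`SplitBounds.exists_solution`): in the variable `z`, forward-backward splitting with a small
step is a contraction of a ball. It needs resolvents with every step size, hence Minty's theorem,
which is obtained by minimizing the Fitzpatrick function plus `‖·‖² / 2`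
(`IsMaximallyMonotoneGraph.exists_resolvent`). Secondly, the distance to a solution is bounded by a
multiple of the residual (`SplitBounds.norm_sub_le`); this gives uniqueness as well.

For differentiability, the bounds pass to the directional derivatives of `a` and `φ`, and the
directional derivative of the resolvent is again the resolvent of a maximally monotone graph
(`isMaximallyMonotoneGraph_derivative`). So the linearized equation is a problem of the same type,
with bounds valid on all of `Y`, and has a unique solution `δ`. By construction the residual of
`y* + t δ` in the problem at `t` is `o(t)`, so stability gives `y_t = y* + t δ + o(t)`
(`exists_differentiable_solution_path`).
-/

/-! ### Strongly convex minimization -/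

/-- Minimization of `z ↦ sup_i (⟪z, w i⟫ - c i) + ‖z‖² / 2`, expressed through its epigraph: if this
function is proper and bounded below, then it has a minimizer, and it grows quadratically away
from it. -/
theorem exists_minimizer_sup_affine_add_sq {Z ι : Type*} [NormedAddCommGroup Z]
    [InnerProductSpace ℝ Z] [CompleteSpace Z] (w : ι → Z) (c : ι → ℝ) (E : Z → ℝ → Prop)
    (hE : ∀ z r, E z r ↔ ∀ i, inner ℝ z (w i) - c i + ‖z‖ ^ 2 / 2 ≤ r)
    (hne : ∃ z r, E z r) (hbdd : ∃ b, ∀ z r, E z r → b ≤ r) :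
    ∃ z₀ m, E z₀ m ∧ ∀ z r, E z r → m + ‖z - z₀‖ ^ 2 / 2 ≤ r := by
  have hconv : ∀ z₁ r₁ z₂ r₂ s, 0 ≤ s → s ≤ 1 → E z₁ r₁ → E z₂ r₂ →
      E (z₁ + s • (z₂ - z₁)) ((1 - s) * r₁ + s * r₂ - s * (1 - s) / 2 * ‖z₂ - z₁‖ ^ 2) := by
    intro z₁ r₁ z₂ r₂ s hs hs' h₁ h₂
    rw [hE] at h₁ h₂ ⊢
    intro i
    have e₁ := mul_le_mul_of_nonneg_left (h₁ i) (sub_nonneg.2 hs')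
    have e₂ := mul_le_mul_of_nonneg_left (h₂ i) hs
    have e₃ : ‖z₁ + s • (z₂ - z₁)‖ ^ 2 =
        (1 - s) * ‖z₁‖ ^ 2 + s * ‖z₂‖ ^ 2 - s * (1 - s) * ‖z₂ - z₁‖ ^ 2 := by
      have h₁ := norm_add_sq_real z₁ (s • (z₂ - z₁))
      rw [norm_smul, inner_smul_right, inner_sub_right, real_inner_self_eq_norm_sq, mul_pow,
        Real.norm_eq_abs, sq_abs] at h₁
      have h₂ := norm_sub_sq_real z₂ z₁
      rw [real_inner_comm] at h₂
      rw [h₁, h₂]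
      ring
    rw [e₃, inner_add_left, inner_smul_left, inner_sub_left]
    simp only [conj_trivial]
    linarith
  obtain ⟨b, hb⟩ := hbdd
  set S : Set ℝ := {r | ∃ z, E z r} with hS
  have hSne : S.Nonempty := by
    obtain ⟨z, r, h⟩ := hne
    exact ⟨r, z, h⟩
  have hSb : BddBelow S := ⟨b, fun r ⟨z, h⟩ => hb z r h⟩
  set m := sInf S
  have hm : ∀ z r, E z r → m ≤ r := fun z r h => csInf_le hSb ⟨z, h⟩
  have hseq : ∀ n : ℕ, ∃ z, E z (m + 1 / ((n : ℝ) + 1)) := by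
    intro n
    have hn : m < m + 1 / ((n : ℝ) + 1) := lt_add_of_pos_right _ (by positivity)
    obtain ⟨r, ⟨z, hz⟩, hr⟩ := exists_lt_of_csInf_lt hSne hn
    exact ⟨z, (hE _ _).2 fun i => ((hE _ _).1 hz i).trans hr.le⟩
  choose z hz using hseq
  have hdist : ∀ N n k : ℕ, N ≤ n → N ≤ k → ‖z n - z k‖ ^ 2 ≤ 8 * (1 / ((N : ℝ) + 1)) := by
    intro N n k hn hk
    -- the midpoint of two almost minimizers cannot beat the infimum
    have h := hm _ _ (hconv _ _ _ _ (1 / 2) (by norm_num) (by norm_num) (hz k) (hz n))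
    have h₁ : 1 / ((n : ℝ) + 1) ≤ 1 / ((N : ℝ) + 1) := by gcongr
    have h₂ : 1 / ((k : ℝ) + 1) ≤ 1 / ((N : ℝ) + 1) := by gcongr
    linarith
  have hlim : Tendsto (fun N : ℕ => 1 / ((N : ℝ) + 1)) atTop (𝓝 0) :=
    tendsto_one_div_add_atTop_nhds_zero_nat
  have hcauchy : CauchySeq z := by
    refine cauchySeq_of_le_tendsto_0 (fun N : ℕ => √(8 * (1 / ((N : ℝ) + 1)))) ?_ ?_
    · intro n k N hn hk
      rw [dist_eq_norm]
      exact Real.le_sqrt_of_sq_le (hdist N n k hn hk)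
    · have := (hlim.const_mul 8).sqrt
      simpa using this
  obtain ⟨z₀, hz₀⟩ := cauchySeq_tendsto_of_complete hcauchy
  have hEm : E z₀ m := by
    rw [hE]
    intro i
    have h₁ : Tendsto (fun n => inner ℝ (z n) (w i) - c i + ‖z n‖ ^ 2 / 2) atTop
        (𝓝 (inner ℝ z₀ (w i) - c i + ‖z₀‖ ^ 2 / 2)) :=
      ((hz₀.inner tendsto_const_nhds).sub_const _).add ((hz₀.norm.pow 2).div_const _)
    have h₂ : Tendsto (fun n : ℕ => m + 1 / ((n : ℝ) + 1)) atTop (𝓝 (m + 0)) :=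
      hlim.const_add m
    rw [add_zero] at h₂
    exact le_of_tendsto_of_tendsto' h₁ h₂ fun n => (hE _ _).1 (hz n) i
  refine ⟨z₀, m, hEm, fun y r hy => ?_⟩
  have key : ∀ s ∈ Ioo (0 : ℝ) 1, m + (1 - s) / 2 * ‖y - z₀‖ ^ 2 ≤ r := by
    intro s hs
    have h := hm _ _ (hconv _ _ _ _ s hs.1.le hs.2.le hEm hy)
    have h' : s * (m + (1 - s) / 2 * ‖y - z₀‖ ^ 2) ≤ s * r := by linarith
    exact le_of_mul_le_mul_left h' hs.1
  have hl : Tendsto (fun s : ℝ => m + (1 - s) / 2 * ‖y - z₀‖ ^ 2) (𝓝[>] 0)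
      (𝓝 (m + ‖y - z₀‖ ^ 2 / 2)) := by
    have hc : Continuous fun s : ℝ => m + (1 - s) / 2 * ‖y - z₀‖ ^ 2 := by fun_prop
    have := (hc.tendsto 0).mono_left (nhdsWithin_le_nhds (s := Ioi 0))
    convert this using 2
    ring
  exact le_of_tendsto hl
    (eventually_of_mem (Ioo_mem_nhdsGT one_pos) key)

/-! ### Monotone graphs and Minty's theorem -/

section Graph

variable {Y : Type*} [NormedAddCommGroup Y] [InnerProductSpace ℝ Y]

/-- The graph of a monotone operator `Y ⇉ Y`, where `Y` is identified with its dual. -/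
def IsMonotoneGraph (M : Set (Y × Y)) : Prop :=
  ∀ p ∈ M, ∀ q ∈ M, 0 ≤ inner ℝ (q.1 - p.1) (q.2 - p.2)

/-- A monotone graph that contains every point which is monotonically related to it. -/
structure IsMaximallyMonotoneGraph (M : Set (Y × Y)) : Prop where
  mono : IsMonotoneGraph M
  mem_of_related : ∀ p : Y × Y, (∀ q ∈ M, 0 ≤ inner ℝ (q.1 - p.1) (q.2 - p.2)) → p ∈ M

/-- The easy half of Minty's theorem: a monotone graph with everywhere defined resolvent is
maximally monotone. -/
theorem IsMonotoneGraph.isMaximallyMonotoneGraph {M : Set (Y × Y)} (hM : IsMonotoneGraph M)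
    (hsurj : ∀ q, ∃ z, (z, q - z) ∈ M) : IsMaximallyMonotoneGraph M := by
  refine ⟨hM, fun p hp => ?_⟩
  obtain ⟨z, hz⟩ := hsurj (p.1 + p.2)
  have h := hp _ hz
  have e : p.1 + p.2 - z - p.2 = -(z - p.1) := by abel
  simp only [e, inner_neg_right, real_inner_self_eq_norm_sq] at h
  have hz0 : z = p.1 := by
    have : ‖z - p.1‖ ^ 2 = 0 := le_antisymm (by linarith) (sq_nonneg _)
    simpa [sub_eq_zero] using this
  subst hz0
  simpa using hz

/-- Minty's theorem at the origin. The Fitzpatrick function of `M` dominates the duality pairing,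
so that adding `‖·‖² / 2` gives a nonnegative strongly convex function on `Y × Y`; optimality of its
minimizer `(x, ξ)` says that `(-ξ, -x)` is monotonically related to `M`. -/
theorem IsMaximallyMonotoneGraph.exists_mem_neg [CompleteSpace Y] {M : Set (Y × Y)}
    (hM : IsMaximallyMonotoneGraph M) : ∃ x, (x, -x) ∈ M := by
  let E : WithLp 2 (Y × Y) → ℝ → Prop := fun z r => ∀ i : M,
    inner ℝ z (WithLp.toLp 2 (i.1.2, i.1.1)) - inner ℝ i.1.1 i.1.2 + ‖z‖ ^ 2 / 2 ≤ r
  have hE : ∀ z r, E z r ↔ ∀ q ∈ M,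
      inner ℝ z.fst q.2 + inner ℝ z.snd q.1 - inner ℝ q.1 q.2
        + (‖z.fst‖ ^ 2 + ‖z.snd‖ ^ 2) / 2 ≤ r := by
    intro z r
    simp only [E, WithLp.prod_inner_apply, WithLp.prod_norm_sq_eq_of_L2, Subtype.forall]
    rfl
  have hlow : ∀ z r, E z r →
      inner ℝ z.fst z.snd + (‖z.fst‖ ^ 2 + ‖z.snd‖ ^ 2) / 2 ≤ r := by
    intro z r hz
    rw [hE] at hz
    by_contra! hlt
    have hmem : (z.fst, z.snd) ∈ M := by
      refine hM.mem_of_related _ fun q hq => ?_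
      have h := hz q hq
      have e := real_inner_comm q.1 z.snd
      simp only [inner_sub_left, inner_sub_right]
      linarith
    have h := hz _ hmem
    have e := real_inner_comm z.fst z.snd
    simp only at h
    linarith
  have hMne : ∃ q, q ∈ M := by
    by_contra! hempty
    exact hempty 0 (hM.mem_of_related 0 fun q hq => absurd hq (hempty q))
  have hEM : ∀ q ∈ M, E (WithLp.toLp 2 q) (inner ℝ q.1 q.2 + (‖q.1‖ ^ 2 + ‖q.2‖ ^ 2) / 2) := by
    intro q hq
    rw [hE]
    intro p hp
    have h := hM.mono p hp q hq
    simp only [inner_sub_left, inner_sub_right] at h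
    have e := real_inner_comm p.1 q.2
    change inner ℝ q.1 p.2 + inner ℝ q.2 p.1 - inner ℝ p.1 p.2
      + (‖q.1‖ ^ 2 + ‖q.2‖ ^ 2) / 2 ≤ _
    linarith
  obtain ⟨z₀, m, hz₀, hmin⟩ := exists_minimizer_sup_affine_add_sq
    (fun i : M => WithLp.toLp 2 (i.1.2, i.1.1)) (fun i : M => inner ℝ i.1.1 i.1.2) E
    (fun _ _ => Iff.rfl)
    (by obtain ⟨q, hq⟩ := hMne; exact ⟨_, _, hEM q hq⟩)
    ⟨0, fun z r h => by
      have h₁ := hlow z r h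
      have h₂ := norm_add_sq_real z.fst z.snd
      have h₃ := sq_nonneg ‖z.fst + z.snd‖
      linarith⟩
  have hm := hlow _ _ hz₀
  have key : ∀ q ∈ M, ‖z₀.fst + z₀.snd‖ ^ 2 ≤ inner ℝ (q.1 - -z₀.snd) (q.2 - -z₀.fst) := by
    intro q hq
    have h := hmin _ _ (hEM q hq)
    rw [WithLp.prod_norm_sq_eq_of_L2] at h
    have h₁ := norm_sub_sq_real q.1 z₀.fst
    have h₂ := norm_sub_sq_real q.2 z₀.snd
    have h₃ := norm_add_sq_real z₀.fst z₀.snd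
    change m + (‖q.1 - z₀.fst‖ ^ 2 + ‖q.2 - z₀.snd‖ ^ 2) / 2 ≤ _ at h
    simp only [sub_neg_eq_add, inner_add_left, inner_add_right]
    have e₁ := real_inner_comm z₀.fst z₀.snd
    have e₂ := real_inner_comm q.2 z₀.snd
    linarith
  have hmem : (-z₀.snd, -z₀.fst) ∈ M :=
    hM.mem_of_related _ fun q hq => (sq_nonneg _).trans (key q hq)
  have h0 := key _ hmem
  simp only [sub_self, inner_zero_left] at h0
  have hz : z₀.fst + z₀.snd = 0 := by
    have : ‖z₀.fst + z₀.snd‖ ^ 2 = 0 := le_antisymm h0 (sq_nonneg _)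
    simpa using this
  refine ⟨z₀.fst, ?_⟩
  rwa [← eq_neg_of_add_eq_zero_left hz] at hmem

/-- Minty's theorem: the resolvent of a maximally monotone graph with any step size `ρ > 0` is
everywhere defined. -/
theorem IsMaximallyMonotoneGraph.exists_resolvent [CompleteSpace Y] {M : Set (Y × Y)}
    (hM : IsMaximallyMonotoneGraph M) {ρ : ℝ} (hρ : 0 < ρ) (q : Y) :
    ∃ z, (z, ρ⁻¹ • (q - z)) ∈ M := by
  have hsub : ∀ a b : Y, ρ⁻¹ • (a + q) - ρ⁻¹ • (b + q) = ρ⁻¹ • (a - b) := by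
    intro a b
    rw [← smul_sub]
    congr 1
    abel
  have hM' : IsMaximallyMonotoneGraph {p : Y × Y | (p.1, ρ⁻¹ • (p.2 + q)) ∈ M} := by
    refine ⟨fun p hp r hr => ?_, fun p hp => hM.mem_of_related _ fun r hr => ?_⟩
    · have h := hM.mono _ hp _ hr
      simp only [hsub, inner_smul_right] at h
      exact nonneg_of_mul_nonneg_right h (inv_pos.2 hρ)
    · have hr' : (r.1, ρ • r.2 - q) ∈ {p : Y × Y | (p.1, ρ⁻¹ • (p.2 + q)) ∈ M} := by
        change (r.1, ρ⁻¹ • (ρ • r.2 - q + q)) ∈ M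
        rwa [sub_add_cancel, smul_smul, inv_mul_cancel₀ hρ.ne', one_smul]
      have h := hp _ hr'
      have e : r.2 - ρ⁻¹ • (p.2 + q) = ρ⁻¹ • (ρ • r.2 - q - p.2) := by
        rw [sub_sub, add_comm q, smul_sub, smul_smul, inv_mul_cancel₀ hρ.ne', one_smul]
      simp only [e, inner_smul_right]
      exact mul_nonneg (inv_pos.2 hρ).le h
  obtain ⟨x, hx⟩ := hM'.exists_mem_neg
  refine ⟨x, ?_⟩
  simpa [sub_eq_neg_add] using hx

end Graph

/-! ### Solvability and stability of the equation with fixed parameter -/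

theorem exists_fixedPoint_closedBall {Y : Type*} [NormedAddCommGroup Y] [CompleteSpace Y]
    (f : Y → Y) (x₀ : Y) {κ r : ℝ} (hr : 0 ≤ r) (hκ0 : 0 ≤ κ) (hκ1 : κ < 1)
    (hf : ∀ x ∈ closedBall x₀ r, ∀ y ∈ closedBall x₀ r, ‖f y - f x‖ ≤ κ * ‖y - x‖)
    (h0 : ‖f x₀ - x₀‖ ≤ (1 - κ) * r) : ∃ x ∈ closedBall x₀ r, f x = x := by
  have hx₀ : x₀ ∈ closedBall x₀ r := mem_closedBall_self hr
  have hmaps : MapsTo f (closedBall x₀ r) (closedBall x₀ r) := by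
    intro x hx
    have h₁ := hf _ hx₀ _ hx
    rw [mem_closedBall, dist_eq_norm] at hx ⊢
    calc ‖f x - x₀‖ ≤ ‖f x - f x₀‖ + ‖f x₀ - x₀‖ := norm_sub_le_norm_sub_add_norm_sub _ _ _
      _ ≤ κ * r + (1 - κ) * r := add_le_add (h₁.trans (by gcongr)) h0
      _ = r := by ring
  have hc : ContractingWith ⟨κ, hκ0⟩ (hmaps.restrict f _ _) := by
    refine ⟨by exact_mod_cast hκ1, LipschitzWith.of_dist_le_mul fun x y => ?_⟩
    have := hf _ y.2 _ x.2
    rw [← dist_eq_norm, ← dist_eq_norm] at this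
    exact this
  obtain ⟨x, hx, hfx, -⟩ := ContractingWith.exists_fixedPoint' isClosed_closedBall.isComplete
    hmaps hc hx₀ (edist_ne_top _ _)
  exact ⟨x, hx, hfx⟩

section Solve

variable {Y : Type*} [NormedAddCommGroup Y] [InnerProductSpace ℝ Y]

/-- Forward-backward splitting: if `(z₀, η₀)` is a point of the maximally monotone graph `M` and `a`
is strongly monotone and Lipschitz on a ball around `z₀`, then `0 ∈ a z + M z` has a solution in
that ball as soon as the residual `a z₀ + η₀` is small relative to the radius. -/
theorem IsMaximallyMonotoneGraph.exists_solution [CompleteSpace Y] {M : Set (Y × Y)}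
    (hM : IsMaximallyMonotoneGraph M) (a : Y → Y) {z₀ η₀ : Y} (hz₀ : (z₀, η₀) ∈ M)
    {c l r : ℝ} (hr : 0 ≤ r) (hc : 0 < c)
    (hmono : ∀ x ∈ closedBall z₀ r, ∀ y ∈ closedBall z₀ r,
      c * ‖y - x‖ ^ 2 ≤ inner ℝ (a y - a x) (y - x))
    (hlip : ∀ x ∈ closedBall z₀ r, ∀ y ∈ closedBall z₀ r, ‖a y - a x‖ ≤ l * ‖y - x‖)
    (hres : ‖a z₀ + η₀‖ ≤ c / 2 * r) : ∃ z ∈ closedBall z₀ r, (z, -a z) ∈ M := by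
  -- with this step size, the forward step is a contraction with factor `1 - ρ c / 2`
  set ρ : ℝ := c / (l ^ 2 + c ^ 2) with hρdef
  have hρ : 0 < ρ := by positivity
  have hρeq : ρ * (l ^ 2 + c ^ 2) = c := by
    rw [hρdef]
    field_simp
  have hρl : ρ * l ^ 2 ≤ c := by nlinarith [mul_nonneg hρ.le (sq_nonneg c)]
  have hρc : ρ * c ≤ 1 := by
    have h : c * (ρ * c) ≤ c * 1 := by nlinarith [mul_nonneg hρ.le (sq_nonneg l)]
    exact le_of_mul_le_mul_left h hc
  choose J hJ using hM.exists_resolvent hρ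
  have hJlip : ∀ p q, ‖J q - J p‖ ≤ ‖q - p‖ := by
    intro p q
    have h := hM.mono _ (hJ p) _ (hJ q)
    simp only [← smul_sub, inner_smul_right] at h
    have h₁ := nonneg_of_mul_nonneg_right h (inv_pos.2 hρ)
    have e : q - J q - (p - J p) = q - p - (J q - J p) := by abel
    rw [e, inner_sub_right, real_inner_self_eq_norm_sq] at h₁
    have h₂ := real_inner_le_norm (J q - J p) (q - p)
    rcases (norm_nonneg (J q - J p)).eq_or_lt' with h0 | h0
    · rw [h0]
      exact norm_nonneg _
    · refine le_of_mul_le_mul_left ?_ h0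
      linarith [sq ‖J q - J p‖]
  have hJz₀ : J (z₀ + ρ • η₀) = z₀ := by
    have h := hM.mono _ (hJ (z₀ + ρ • η₀)) _ hz₀
    have e : η₀ - ρ⁻¹ • (z₀ + ρ • η₀ - J (z₀ + ρ • η₀)) =
        -(ρ⁻¹ • (z₀ - J (z₀ + ρ • η₀))) := by
      rw [add_sub_right_comm, smul_add, smul_smul, inv_mul_cancel₀ hρ.ne', one_smul]
      abel
    simp only [e, inner_neg_right, inner_smul_right, real_inner_self_eq_norm_sq] at h
    have h₁ : ‖z₀ - J (z₀ + ρ • η₀)‖ ^ 2 = 0 := by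
      refine le_antisymm ?_ (sq_nonneg _)
      have : 0 < ρ⁻¹ := inv_pos.2 hρ
      by_contra! hlt
      linarith [mul_pos this hlt]
    have h₂ : z₀ - J (z₀ + ρ • η₀) = 0 := by simpa using h₁
    exact (sub_eq_zero.1 h₂).symm
  obtain ⟨z, hz, hfz⟩ : ∃ z ∈ closedBall z₀ r, J (z - ρ • a z) = z := by
    refine exists_fixedPoint_closedBall (fun z => J (z - ρ • a z)) z₀ (κ := 1 - ρ * c / 2) hr
      (by linarith) (by nlinarith [mul_pos hρ hc]) ?_ ?_
    · intro x hx y hy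
      refine (hJlip _ _).trans ?_
      have e : y - ρ • a y - (x - ρ • a x) = (y - x) - ρ • (a y - a x) := by
        rw [smul_sub]
        abel
      rw [e]
      refine abs_le_of_sq_le_sq' ?_ ?_ |>.2
      · rw [norm_sub_sq_real, inner_smul_right, norm_smul, mul_pow, mul_pow, Real.norm_eq_abs,
          sq_abs, real_inner_comm]
        have h₁ := mul_le_mul_of_nonneg_left (hmono x hx y hy) hρ.le
        have h₂ : ‖a y - a x‖ ^ 2 ≤ l ^ 2 * ‖y - x‖ ^ 2 := by
          rw [← mul_pow]
          exact pow_le_pow_left₀ (norm_nonneg _) (hlip x hx y hy) 2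
        have h₃ := mul_le_mul_of_nonneg_left h₂ (sq_nonneg ρ)
        have h₄ := mul_le_mul_of_nonneg_right hρl (mul_nonneg hρ.le (sq_nonneg ‖y - x‖))
        nlinarith [mul_nonneg (sq_nonneg (ρ * c)) (sq_nonneg ‖y - x‖)]
      · exact mul_nonneg (by linarith) (norm_nonneg _)
    · have h := hJlip (z₀ + ρ • η₀) (z₀ - ρ • a z₀)
      rw [hJz₀] at h
      have e : z₀ - ρ • a z₀ - (z₀ + ρ • η₀) = -(ρ • (a z₀ + η₀)) := by
        rw [smul_add]
        abel
      rw [e, norm_neg, norm_smul, Real.norm_eq_abs, abs_of_pos hρ] at h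
      refine h.trans ?_
      have := mul_le_mul_of_nonneg_left hres hρ.le
      linarith
  refine ⟨z, hz, ?_⟩
  have h := hJ (z - ρ • a z)
  rw [hfz] at h
  simpa [smul_smul, inv_mul_cancel₀ hρ.ne'] using h

/-- Estimates on a set `D` for a map `a` (an operator `Y → Y⋆` after identification of `Y` with its
dual) and a map `φ`: Lipschitz bounds `L` and `l`, and strong monotonicity, with constant `c`, of
`a` relative to the displacement `y - φ y`. -/
structure SplitBounds (a φ : Y → Y) (D : Set Y) (c L l : ℝ) : Prop where
  lip : ∀ x ∈ D, ∀ y ∈ D, ‖a y - a x‖ ≤ L * ‖y - x‖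
  contr : ∀ x ∈ D, ∀ y ∈ D, ‖φ y - φ x‖ ≤ l * ‖y - x‖
  mono : ∀ x ∈ D, ∀ y ∈ D, c * ‖y - x‖ ^ 2 ≤ inner ℝ (a y - a x) ((y - φ y) - (x - φ x))

/-- Solvability of `-a y ∈ M (y - φ y)` near an approximate solution `y₀`, obtained by rewriting the
problem in the variable `z = y - φ y`. -/
theorem SplitBounds.exists_solution [CompleteSpace Y] {M : Set (Y × Y)}
    (hM : IsMaximallyMonotoneGraph M) {a φ : Y → Y} {y₀ z₀ η₀ : Y} {c L l r : ℝ}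
    (hb : SplitBounds a φ (closedBall y₀ r) c L l) (hz₀ : (z₀, η₀) ∈ M) (hr : 0 ≤ r) (hc : 0 < c)
    (hL : 0 ≤ L) (hl0 : 0 ≤ l) (hl1 : l < 1)
    (h₁ : ‖z₀ - (y₀ - φ y₀)‖ ≤ (1 - l) * r / 2)
    (h₂ : ‖a y₀ + η₀‖ + L / (1 - l) * ‖z₀ - (y₀ - φ y₀)‖ ≤ c * (1 - l) * r / 16) :
    ∃ y ∈ closedBall y₀ r, (y - φ y, -a y) ∈ M := by
  have hl : 0 < 1 - l := sub_pos.2 hl1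
  have hy₀ : y₀ ∈ closedBall y₀ r := mem_closedBall_self hr
  have hinv : ∀ w : Y, ∃ y, w ∈ closedBall z₀ ((1 - l) * r / 2) →
      y ∈ closedBall y₀ r ∧ y - φ y = w := by
    intro w
    by_cases hw : w ∈ closedBall z₀ ((1 - l) * r / 2)
    · obtain ⟨y, hy, hfy⟩ := exists_fixedPoint_closedBall (fun y => w + φ y) y₀ hr hl0 hl1
        (fun x hx y hy => by simpa using hb.contr x hx y hy) (by
          rw [mem_closedBall, dist_eq_norm] at hw
          have e : w + φ y₀ - y₀ = (w - z₀) + (z₀ - (y₀ - φ y₀)) := by abel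
          rw [e]
          exact (norm_add_le _ _).trans (by linarith))
      exact ⟨y, fun _ => ⟨hy, by rw [sub_eq_iff_eq_add]; exact hfy.symm⟩⟩
    · exact ⟨0, fun h => absurd h hw⟩
  choose S hS using hinv
  -- bounds for `y - φ y` in both directions
  have hlow : ∀ x ∈ closedBall y₀ r, ∀ y ∈ closedBall y₀ r,
      ‖y - x‖ ≤ ‖(y - φ y) - (x - φ x)‖ / (1 - l) := by
    intro x hx y hy
    have h := hb.contr x hx y hy
    have e : y - x = (y - φ y) - (x - φ x) + (φ y - φ x) := by abel
    have h' : ‖y - x‖ ≤ ‖(y - φ y) - (x - φ x)‖ + ‖φ y - φ x‖ := by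
      conv_lhs => rw [e]
      exact norm_add_le _ _
    rw [le_div_iff₀ hl]
    linarith
  have hup : ∀ x ∈ closedBall y₀ r, ∀ y ∈ closedBall y₀ r,
      ‖(y - φ y) - (x - φ x)‖ ≤ 2 * ‖y - x‖ := by
    intro x hx y hy
    have h := hb.contr x hx y hy
    have e : (y - φ y) - (x - φ x) = (y - x) - (φ y - φ x) := by abel
    rw [e]
    have h₃ := norm_sub_le (y - x) (φ y - φ x)
    have h₄ : l * ‖y - x‖ ≤ 1 * ‖y - x‖ := by gcongr
    linarith
  have hr' : 0 ≤ (1 - l) * r / 2 := by positivity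
  have hz₀' := hS z₀ (mem_closedBall_self hr')
  obtain ⟨z, hz, hzM⟩ : ∃ z ∈ closedBall z₀ ((1 - l) * r / 2), (z, -a (S z)) ∈ M := by
    refine hM.exists_solution (fun z => a (S z)) hz₀ (c := c / 4) (l := L / (1 - l)) hr'
      (by positivity) ?_ ?_ ?_
    · intro x hx y hy
      have h := hb.mono _ (hS x hx).1 _ (hS y hy).1
      have h₃ := hup _ (hS x hx).1 _ (hS y hy).1
      rw [(hS x hx).2, (hS y hy).2] at h h₃
      refine le_trans ?_ h
      have h₄ := pow_le_pow_left₀ (norm_nonneg _) h₃ 2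
      nlinarith
    · intro x hx y hy
      have h := hb.lip _ (hS x hx).1 _ (hS y hy).1
      have h₃ := hlow _ (hS x hx).1 _ (hS y hy).1
      rw [(hS x hx).2, (hS y hy).2] at h₃
      calc ‖a (S y) - a (S x)‖ ≤ L * ‖S y - S x‖ := h
        _ ≤ L * (‖y - x‖ / (1 - l)) := by gcongr
        _ = L / (1 - l) * ‖y - x‖ := by ring
    · have h := hb.lip _ hy₀ _ hz₀'.1
      have h₃ := hlow _ hy₀ _ hz₀'.1
      rw [hz₀'.2] at h₃
      have e : a (S z₀) + η₀ = (a (S z₀) - a y₀) + (a y₀ + η₀) := by abel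
      rw [e]
      have h₄ : L * ‖S z₀ - y₀‖ ≤ L * (‖z₀ - (y₀ - φ y₀)‖ / (1 - l)) := by gcongr
      have h₅ := norm_add_le (a (S z₀) - a y₀) (a y₀ + η₀)
      have e₁ : L * (‖z₀ - (y₀ - φ y₀)‖ / (1 - l)) = L / (1 - l) * ‖z₀ - (y₀ - φ y₀)‖ := by ring
      linarith
  have h := hS z hz
  refine ⟨S z, h.1, ?_⟩
  rw [h.2]
  exact hzM

/-- Stability: the distance of `y` to a solution `x` is controlled by the residuals of `y`. -/
theorem SplitBounds.norm_sub_le {M : Set (Y × Y)} (hM : IsMonotoneGraph M) {a φ : Y → Y}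
    {D : Set Y} {c L l : ℝ} (hb : SplitBounds a φ D c L l) (hc : 0 < c) (hL : 0 ≤ L) (hl1 : l ≤ 1)
    {x y z η : Y} (hx : x ∈ D) (hy : y ∈ D) (hxM : (x - φ x, -a x) ∈ M) (hzM : (z, η) ∈ M) :
    ‖y - x‖ ≤ ((3 + L) / c + 1) * (‖z - (y - φ y)‖ + ‖a y + η‖) := by
  have h := hM _ hxM _ hzM
  have h₁ := hb.mono x hx y hy
  have h₂ := hb.lip x hx y hy
  have h₃ := hb.contr x hx y hy
  set s := z - (y - φ y) with hs
  set ρ := a y + η with hρ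
  have e₁ : z - (x - φ x) = ((y - φ y) - (x - φ x)) + s := by rw [hs]; abel
  have e₂ : η - -a x = ρ - (a y - a x) := by rw [hρ]; abel
  simp only [e₁, e₂] at h
  set T := (y - φ y) - (x - φ x) with hT
  have hTn : ‖T‖ ≤ 2 * ‖y - x‖ := by
    have e : T = (y - x) - (φ y - φ x) := by rw [hT]; abel
    rw [e]
    have h₄ := _root_.norm_sub_le (y - x) (φ y - φ x)
    have h₅ : l * ‖y - x‖ ≤ 1 * ‖y - x‖ := by gcongr
    linarith
  rw [inner_sub_right, inner_add_left, inner_add_left, real_inner_comm (a y - a x) T] at h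
  have i₁ := real_inner_le_norm T ρ
  have i₂ := real_inner_le_norm s ρ
  have i₃ := neg_le_of_abs_le (abs_real_inner_le_norm s (a y - a x))
  set d := ‖y - x‖
  set e := ‖s‖ + ‖ρ‖ with he
  have hd : 0 ≤ d := norm_nonneg _
  have hs0 : 0 ≤ ‖s‖ := norm_nonneg _
  have hρ0 : 0 ≤ ‖ρ‖ := norm_nonneg _
  have j₁ : ‖T‖ * ‖ρ‖ ≤ 2 * d * ‖ρ‖ := by gcongr
  have j₃ : ‖s‖ * ‖a y - a x‖ ≤ ‖s‖ * (L * d) := by gcongr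
  have main : c * d ^ 2 ≤ (2 + L) * e * d + e ^ 2 := by
    have k₁ : 0 ≤ L * d * ‖ρ‖ := by positivity
    have k₂ : 0 ≤ d * ‖s‖ := by positivity
    have k₃ : 0 ≤ ‖s‖ * ‖ρ‖ := by positivity
    rw [he]
    nlinarith [sq_nonneg ‖s‖, sq_nonneg ‖ρ‖]
  have he0 : 0 ≤ e := by positivity
  by_contra! hlt
  have hK : 0 ≤ (3 + L) / c := by positivity
  have hed : e ≤ d := by nlinarith [mul_nonneg hK he0]
  have hd0 : 0 < d := lt_of_le_of_lt (by positivity) hlt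
  have m₁ : d * (c * d) ≤ d * ((3 + L) * e) := by nlinarith
  have m₂ := le_of_mul_le_mul_left m₁ hd0
  have m₃ : d ≤ (3 + L) / c * e := by
    rw [div_mul_eq_mul_div, le_div_iff₀ hc]
    linarith
  linarith

/-- A strongly monotone perturbation may be compensated by a small contraction. -/
theorem SplitBounds.of_small_lipschitz {a φ : Y → Y} {D : Set Y} {μ L l : ℝ} (hL : 0 ≤ L)
    (hmono : ∀ x ∈ D, ∀ y ∈ D, μ * ‖y - x‖ ^ 2 ≤ inner ℝ (a y - a x) (y - x))
    (hlip : ∀ x ∈ D, ∀ y ∈ D, ‖a y - a x‖ ≤ L * ‖y - x‖)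
    (hcontr : ∀ x ∈ D, ∀ y ∈ D, ‖φ y - φ x‖ ≤ l * ‖y - x‖) :
    SplitBounds a φ D (μ - L * l) L l := by
  refine ⟨hlip, hcontr, fun x hx y hy => ?_⟩
  have e : (y - φ y) - (x - φ x) = (y - x) - (φ y - φ x) := by abel
  rw [e, inner_sub_right]
  have h₁ := hmono x hx y hy
  have h₂ : ‖a y - a x‖ * ‖φ y - φ x‖ ≤ (L * ‖y - x‖) * (l * ‖y - x‖) := by
    gcongr
    · exact hlip x hx y hy
    · exact hcontr x hx y hy
  have h₃ := real_inner_le_norm (a y - a x) (φ y - φ x)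
  linarith

/-- For cocoercive `a`, completing the square yields a weaker smallness condition on `l`. -/
theorem SplitBounds.of_cocoercive {a φ : Y → Y} {D : Set Y} {μ L l : ℝ} (hμ : 0 < μ)
    (hL : 0 < L)
    (hco : ∀ x ∈ D, ∀ y ∈ D, ‖a y - a x‖ ^ 2 + μ * L * ‖y - x‖ ^ 2 ≤
      (L + μ) * inner ℝ (a y - a x) (y - x))
    (hlip : ∀ x ∈ D, ∀ y ∈ D, ‖a y - a x‖ ≤ L * ‖y - x‖)
    (hcontr : ∀ x ∈ D, ∀ y ∈ D, ‖φ y - φ x‖ ≤ l * ‖y - x‖) :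
    SplitBounds a φ D (μ * L / (L + μ) - (L + μ) * l ^ 2 / 4) L l := by
  refine ⟨hlip, hcontr, fun x hx y hy => ?_⟩
  have e : (y - φ y) - (x - φ x) = (y - x) - (φ y - φ x) := by abel
  rw [e, inner_sub_right]
  have h₁ := hco x hx y hy
  have hP : 0 < L + μ := by positivity
  have h₂ : ‖a y - a x‖ * ‖φ y - φ x‖ ≤ ‖a y - a x‖ * (l * ‖y - x‖) := by
    gcongr
    exact hcontr x hx y hy
  have h₃ := real_inner_le_norm (a y - a x) (φ y - φ x)
  have h₄ : ((L + μ) * l * ‖y - x‖ / 2) * (2 * ‖a y - a x‖ - (L + μ) * l * ‖y - x‖ / 2) ≤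
      ‖a y - a x‖ ^ 2 := by
    nlinarith [sq_nonneg (‖a y - a x‖ - (L + μ) * l * ‖y - x‖ / 2)]
  refine le_of_mul_le_mul_left ?_ hP
  have e₂ : (L + μ) * ((μ * L / (L + μ) - (L + μ) * l ^ 2 / 4) * ‖y - x‖ ^ 2) =
      μ * L * ‖y - x‖ ^ 2 - (L + μ) ^ 2 * l ^ 2 / 4 * ‖y - x‖ ^ 2 := by
    field_simp
  rw [e₂]
  have h₅ := mul_le_mul_of_nonneg_left (h₃.trans h₂) hP.le
  linarith

end Solve

/-! ### Cocoercivity of gradients on balls -/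

section Gradient

variable {Y : Type*} [NormedAddCommGroup Y] [InnerProductSpace ℝ Y] [CompleteSpace Y]

/-- First order bounds for a function on a convex set whose gradient `b` satisfies
`0 ≤ ⟪b y - b x, y - x⟫ ≤ l ‖y - x‖²`. -/
theorem gradient_bounds {f : Y → ℝ} {b : Y → Y} {D : Set Y} (hD : Convex ℝ D) {l : ℝ}
    (hf : ∀ x ∈ D, HasGradientAt f (b x) x)
    (h0 : ∀ x ∈ D, ∀ y ∈ D, 0 ≤ inner ℝ (b y - b x) (y - x))
    (hl : ∀ x ∈ D, ∀ y ∈ D, inner ℝ (b y - b x) (y - x) ≤ l * ‖y - x‖ ^ 2)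
    {x y : Y} (hx : x ∈ D) (hy : y ∈ D) :
    f x + inner ℝ (b x) (y - x) ≤ f y ∧
      f y ≤ f x + inner ℝ (b x) (y - x) + l / 2 * ‖y - x‖ ^ 2 := by
  have hmem : ∀ s ∈ Icc (0 : ℝ) 1, x + s • (y - x) ∈ D := fun s hs =>
    hD.add_smul_sub_mem hx hy hs
  have hder : ∀ s ∈ Icc (0 : ℝ) 1, HasDerivAt (fun s : ℝ => f (x + s • (y - x)))
      (inner ℝ (b (x + s • (y - x))) (y - x)) s := by
    intro s hs
    have h₁ : HasDerivAt (fun s : ℝ => x + s • (y - x)) (y - x) s := by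
      simpa using ((hasDerivAt_id s).smul_const (y - x)).const_add x
    have h₂ := (hf _ (hmem s hs)).hasFDerivAt.comp_hasDerivAt s h₁
    exact h₂.congr_deriv (by simp)
  have hnonneg : ∀ s ∈ Ioo (0 : ℝ) 1,
      0 ≤ inner ℝ (b (x + s • (y - x)) - b x) (y - x) ∧
        inner ℝ (b (x + s • (y - x)) - b x) (y - x) ≤ l * s * ‖y - x‖ ^ 2 := by
    intro s hs
    have e : x + s • (y - x) - x = s • (y - x) := by abel
    have h₁ := h0 x hx _ (hmem s (Ioo_subset_Icc_self hs))
    have h₂ := hl x hx _ (hmem s (Ioo_subset_Icc_self hs))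
    rw [e, inner_smul_right] at h₁ h₂
    rw [norm_smul, mul_pow, Real.norm_eq_abs, sq_abs] at h₂
    refine ⟨nonneg_of_mul_nonneg_right h₁ hs.1, le_of_mul_le_mul_left ?_ hs.1⟩
    linarith
  have hlin : ∀ s : ℝ, HasDerivAt (fun s : ℝ => s * inner ℝ (b x) (y - x))
      (inner ℝ (b x) (y - x)) s := fun s => by
    simpa using (hasDerivAt_id s).mul_const (inner ℝ (b x) (y - x))
  have hquad : ∀ s : ℝ, HasDerivAt (fun s : ℝ => s ^ 2 * (l / 2 * ‖y - x‖ ^ 2))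
      (l * s * ‖y - x‖ ^ 2) s := fun s => by
    refine ((hasDerivAt_pow 2 s).mul_const (l / 2 * ‖y - x‖ ^ 2)).congr_deriv ?_
    norm_num
    ring
  constructor
  · obtain ⟨s, hs, he⟩ := exists_hasDerivAt_eq_slope
      (fun s : ℝ => f (x + s • (y - x)) - s * inner ℝ (b x) (y - x)) _ one_pos
      (fun s hs => ((hder s hs).sub (hlin s)).continuousAt.continuousWithinAt)
      (fun s hs => (hder s (Ioo_subset_Icc_self hs)).sub (hlin s))
    have h := (hnonneg s hs).1
    rw [inner_sub_left, he] at h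
    simp only [one_smul, zero_smul, add_zero, add_sub_cancel, one_mul, zero_mul, sub_zero,
      div_one] at h
    linarith
  · obtain ⟨s, hs, he⟩ := exists_hasDerivAt_eq_slope
      (fun s : ℝ => f (x + s • (y - x)) - s * inner ℝ (b x) (y - x)
        - s ^ 2 * (l / 2 * ‖y - x‖ ^ 2)) _ one_pos
      (fun s hs => (((hder s hs).sub (hlin s)).sub (hquad s)).continuousAt.continuousWithinAt)
      (fun s hs => ((hder s (Ioo_subset_Icc_self hs)).sub (hlin s)).sub (hquad s))
    have h := (hnonneg s hs).2
    rw [inner_sub_left, ← sub_nonpos, he] at h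
    simp only [one_smul, zero_smul, add_zero, add_sub_cancel, one_mul, zero_mul, sub_zero,
      div_one, one_pow, ne_eq, OfNat.ofNat_ne_zero, not_false_eq_true, zero_pow] at h
    linarith

/-- The classical proof of cocoercivity compares `f` at `x` and `y` with its values after a gradient
step of length `l⁻¹`; it only needs that these steps do not leave `D`. -/
theorem gradient_cocoercive_of_step_mem {f : Y → ℝ} {b : Y → Y} {D : Set Y} (hD : Convex ℝ D)
    {l : ℝ} (hlpos : 0 < l) (hf : ∀ x ∈ D, HasGradientAt f (b x) x)
    (h0 : ∀ x ∈ D, ∀ y ∈ D, 0 ≤ inner ℝ (b y - b x) (y - x))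
    (hl : ∀ x ∈ D, ∀ y ∈ D, inner ℝ (b y - b x) (y - x) ≤ l * ‖y - x‖ ^ 2)
    {x y : Y} (hx : x ∈ D) (hy : y ∈ D) (hx' : x + l⁻¹ • (b y - b x) ∈ D)
    (hy' : y - l⁻¹ • (b y - b x) ∈ D) :
    ‖b y - b x‖ ^ 2 ≤ l * inner ℝ (b y - b x) (y - x) := by
  have key : ∀ x ∈ D, ∀ y ∈ D, y - l⁻¹ • (b y - b x) ∈ D →
      ‖b y - b x‖ ^ 2 ≤ 2 * l * (f y - f x - inner ℝ (b x) (y - x)) := by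
    intro x hx y hy hz
    have h₁ := (gradient_bounds hD hf h0 hl hx hz).1
    have h₂ := (gradient_bounds hD hf h0 hl hy hz).2
    have e₁ : y - l⁻¹ • (b y - b x) - x = (y - x) - l⁻¹ • (b y - b x) := by abel
    have e₂ : y - l⁻¹ • (b y - b x) - y = -(l⁻¹ • (b y - b x)) := by abel
    have e₃ : inner ℝ (b y) (b y - b x) = inner ℝ (b x) (b y - b x) + ‖b y - b x‖ ^ 2 := by
      rw [← real_inner_self_eq_norm_sq, inner_sub_left (b y) (b x)]
      ring
    rw [e₁, inner_sub_right, inner_smul_right] at h₁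
    rw [e₂, inner_neg_right, inner_smul_right, norm_neg, norm_smul, mul_pow, Real.norm_eq_abs,
      sq_abs, e₃] at h₂
    have h₃ : l⁻¹ * ‖b y - b x‖ ^ 2 / 2 ≤ f y - f x - inner ℝ (b x) (y - x) := by
      have e₄ : l / 2 * (l⁻¹ ^ 2 * ‖b y - b x‖ ^ 2) = l⁻¹ * ‖b y - b x‖ ^ 2 / 2 := by
        field_simp
      rw [e₄] at h₂
      linarith
    calc ‖b y - b x‖ ^ 2 = 2 * l * (l⁻¹ * ‖b y - b x‖ ^ 2 / 2) := by field_simp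
      _ ≤ _ := by gcongr
  have h₁ := key x hx y hy hy'
  have h₂ := key y hy x hx (by
    have e : x - l⁻¹ • (b x - b y) = x + l⁻¹ • (b y - b x) := by
      rw [← neg_sub (b y), smul_neg, sub_neg_eq_add]
    rwa [e])
  have e₁ : ‖b x - b y‖ = ‖b y - b x‖ := norm_sub_rev _ _
  have e₂ : inner ℝ (b y) (x - y) = -inner ℝ (b y) (y - x) := by
    rw [← inner_neg_right, neg_sub]
  rw [e₁, e₂] at h₂
  rw [inner_sub_left]
  linarith

/-- The Baillon–Haddad inequality on a ball. The gradient steps of the classical argument may leave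
the ball, so the segment from `x` to `y` is cut into short pieces and the inequalities on the pieces
are added up. -/
theorem gradient_cocoercive_ball {f : Y → ℝ} {b : Y → Y} {c : Y} {ε : ℝ}
    {l K : ℝ} (hlpos : 0 < l) (hf : ∀ x ∈ ball c ε, HasGradientAt f (b x) x)
    (h0 : ∀ x ∈ ball c ε, ∀ y ∈ ball c ε, 0 ≤ inner ℝ (b y - b x) (y - x))
    (hl : ∀ x ∈ ball c ε, ∀ y ∈ ball c ε, inner ℝ (b y - b x) (y - x) ≤ l * ‖y - x‖ ^ 2)
    (hlip : ∀ x ∈ ball c ε, ∀ y ∈ ball c ε, ‖b y - b x‖ ≤ K * ‖y - x‖)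
    {x y : Y} (hx : x ∈ ball c ε) (hy : y ∈ ball c ε) :
    ‖b y - b x‖ ^ 2 ≤ l * inner ℝ (b y - b x) (y - x) := by
  set ρ := max (dist x c) (dist y c) with hρ
  have hρε : ρ < ε := max_lt hx hy
  obtain ⟨n, hn⟩ := exists_nat_gt (l⁻¹ * (K * ‖y - x‖) / (ε - ρ))
  set N : ℕ := n + 1
  have hN : (0 : ℝ) < N := by positivity
  have hNlt : l⁻¹ * (K * (‖y - x‖ / N)) < ε - ρ := by
    have h₁ : l⁻¹ * (K * ‖y - x‖) / (ε - ρ) < N := hn.trans (by simp [N])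
    rw [div_lt_iff₀ (sub_pos.2 hρε)] at h₁
    have e : l⁻¹ * (K * (‖y - x‖ / N)) = l⁻¹ * (K * ‖y - x‖) / N := by ring
    rw [e, div_lt_iff₀ hN]
    linarith
  let p : ℕ → Y := fun i => x + ((i : ℝ) / N) • (y - x)
  have hp : ∀ i ≤ N, p i ∈ closedBall c ρ := by
    intro i hi
    refine (convex_closedBall c ρ).add_smul_sub_mem
      (mem_closedBall.2 (le_max_left _ _)) (mem_closedBall.2 (le_max_right _ _)) ⟨by positivity, ?_⟩
    rw [div_le_one hN]
    exact_mod_cast hi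
  have hpb : ∀ i ≤ N, p i ∈ ball c ε := fun i hi =>
    closedBall_subset_ball hρε (hp i hi)
  have hstep : ∀ i, p (i + 1) - p i = (N : ℝ)⁻¹ • (y - x) := by
    intro i
    simp only [p, add_sub_add_left_eq_sub, ← sub_smul]
    congr 1
    push_cast
    ring
  have hpiece : ∀ i < N, N * ‖b (p (i + 1)) - b (p i)‖ ^ 2 ≤
      l * inner ℝ (b (p (i + 1)) - b (p i)) (y - x) := by
    intro i hi
    have hi₀ := hpb i hi.le
    have hi₁ := hpb (i + 1) hi
    have hsmall : ‖l⁻¹ • (b (p (i + 1)) - b (p i))‖ < ε - ρ := by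
      refine lt_of_le_of_lt ?_ hNlt
      have h := hlip _ hi₀ _ hi₁
      rw [hstep, norm_smul, norm_inv, Real.norm_natCast, inv_mul_eq_div] at h
      rw [norm_smul, norm_inv, Real.norm_of_nonneg hlpos.le]
      gcongr
    have h := gradient_cocoercive_of_step_mem (convex_ball c ε) hlpos hf h0 hl hi₀ hi₁ (by
        have h₁ := hp i hi.le
        rw [mem_closedBall, dist_eq_norm] at h₁
        rw [mem_ball, dist_eq_norm, add_sub_right_comm]
        exact (norm_add_le _ _).trans_lt (by linarith)) (by
        have h₁ := hp (i + 1) hi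
        rw [mem_closedBall, dist_eq_norm] at h₁
        rw [mem_ball, dist_eq_norm, sub_right_comm]
        exact (norm_sub_le _ _).trans_lt (by linarith))
    rw [hstep, inner_smul_right] at h
    have h' := mul_le_mul_of_nonneg_left h hN.le
    refine h'.trans_eq ?_
    field_simp
  have hp0 : p 0 = x := by simp [p]
  have hpN : p N = y := by
    simp only [p]
    rw [div_self hN.ne', one_smul, add_sub_cancel]
  have htel : b y - b x = ∑ i ∈ Finset.range N, (b (p (i + 1)) - b (p i)) := by
    rw [Finset.sum_range_sub (fun i => b (p i)), hp0, hpN]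
  have hsq : ‖b y - b x‖ ^ 2 ≤
      N * ∑ i ∈ Finset.range N, ‖b (p (i + 1)) - b (p i)‖ ^ 2 := by
    have h₁ : ‖b y - b x‖ ≤ ∑ i ∈ Finset.range N, ‖b (p (i + 1)) - b (p i)‖ := by
      rw [htel]
      exact norm_sum_le _ _
    have h₂ := sq_sum_le_card_mul_sum_sq (s := Finset.range N)
      (f := fun i => ‖b (p (i + 1)) - b (p i)‖)
    rw [Finset.card_range] at h₂
    exact (pow_le_pow_left₀ (norm_nonneg _) h₁ 2).trans h₂
  refine hsq.trans ?_
  rw [htel, sum_inner, Finset.mul_sum, Finset.mul_sum]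
  exact Finset.sum_le_sum fun i hi => hpiece i (Finset.mem_range.1 hi)

/-- A strongly monotone Lipschitz gradient is cocoercive after subtracting the strongly monotone
part; in expanded form, this is the following inequality. -/
theorem gradient_strong_cocoercive {g : Y → ℝ} {a : Y → Y} {c : Y} {ε μ L : ℝ} (hε : 0 < ε)
    (hμ : 0 < μ) (hL : 0 < L) (hg : ∀ x ∈ ball c ε, HasGradientAt g (a x) x)
    (hmono : ∀ x ∈ closedBall c ε, ∀ y ∈ closedBall c ε,
      μ * ‖y - x‖ ^ 2 ≤ inner ℝ (a y - a x) (y - x))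
    (hlip : ∀ x ∈ closedBall c ε, ∀ y ∈ closedBall c ε, ‖a y - a x‖ ≤ L * ‖y - x‖)
    {x y : Y} (hx : x ∈ closedBall c ε) (hy : y ∈ closedBall c ε) :
    ‖a y - a x‖ ^ 2 + μ * L * ‖y - x‖ ^ 2 ≤ (L + μ) * inner ℝ (a y - a x) (y - x) := by
  have hsub : ball c ε ⊆ closedBall c ε := ball_subset_closedBall
  have hpert : ∀ x y : Y, a y - μ • y - (a x - μ • x) = (a y - a x) - μ • (y - x) := by
    intro x y
    rw [smul_sub]
    abel
  have hin : ∀ x y : Y, inner ℝ (a y - μ • y - (a x - μ • x)) (y - x) =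
      inner ℝ (a y - a x) (y - x) - μ * ‖y - x‖ ^ 2 := by
    intro x y
    rw [hpert, inner_sub_left, inner_smul_left, real_inner_self_eq_norm_sq]
    simp
  -- `L` is increased to some `L' > μ`, so that `L' - μ` can be inverted
  have hstrict : ∀ x ∈ ball c ε, ∀ y ∈ ball c ε, ∀ L' ∈ Ioi (max L μ),
      ‖a y - a x‖ ^ 2 + μ * L' * ‖y - x‖ ^ 2 ≤ (L' + μ) * inner ℝ (a y - a x) (y - x) := by
    intro x hx y hy L' hL'
    have hL₁ : L < L' := (le_max_left _ _).trans_lt hL'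
    have hL₂ : μ < L' := (le_max_right _ _).trans_lt hL'
    have h := gradient_cocoercive_ball (f := fun z => g z - μ / 2 * ‖z‖ ^ 2)
      (b := fun z => a z - μ • z) (c := c) (ε := ε) (l := L' - μ) (K := L + μ) (sub_pos.2 hL₂)
      ?_ ?_ ?_ ?_ hx hy
    · simp only [hin] at h
      rw [hpert, norm_sub_sq_real, inner_smul_right, norm_smul, mul_pow, Real.norm_eq_abs,
        sq_abs] at h
      linarith
    · intro z hz
      rw [hasGradientAt_iff_hasFDerivAt]
      have h₁ := (hg z hz).hasFDerivAt
      have h₂ := ((hasStrictFDerivAt_norm_sq z).hasFDerivAt.const_mul (μ / 2))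
      refine (h₁.sub h₂).congr_fderiv ?_
      ext v
      simp
      ring
    · intro x hx y hy
      simp only [hin]
      linarith [hmono x (hsub hx) y (hsub hy)]
    · intro x hx y hy
      simp only [hin]
      have h₁ := real_inner_le_norm (a y - a x) (y - x)
      have h₂ : ‖a y - a x‖ * ‖y - x‖ ≤ (L' * ‖y - x‖) * ‖y - x‖ := by
        gcongr
        exact (hlip x (hsub hx) y (hsub hy)).trans (by gcongr)
      linarith
    · intro x hx y hy
      rw [hpert]
      refine (norm_sub_le _ _).trans ?_
      rw [norm_smul, Real.norm_of_nonneg hμ.le]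
      linarith [hlip x (hsub hx) y (hsub hy)]
  by_cases hYt : ∃ x ∈ closedBall c ε, ∃ y ∈ closedBall c ε, x ≠ y
  swap
  · push Not at hYt
    simp [hYt x hx y hy]
  have hμL : μ ≤ L := by
    obtain ⟨x, hx, y, hy, hxy⟩ := hYt
    have hpos : 0 < ‖y - x‖ := norm_pos_iff.2 (sub_ne_zero.2 hxy.symm)
    have h₁ := (hmono x hx y hy).trans (real_inner_le_norm _ _)
    have h₂ : ‖a y - a x‖ * ‖y - x‖ ≤ (L * ‖y - x‖) * ‖y - x‖ := by
      gcongr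
      exact hlip x hx y hy
    have h₃ : μ * ‖y - x‖ ^ 2 ≤ L * ‖y - x‖ ^ 2 := by linarith
    exact le_of_mul_le_mul_right h₃ (by positivity)
  have hball : ∀ x ∈ ball c ε, ∀ y ∈ ball c ε,
      ‖a y - a x‖ ^ 2 + μ * L * ‖y - x‖ ^ 2 ≤ (L + μ) * inner ℝ (a y - a x) (y - x) := by
    intro x hx y hy
    have h₁ : Continuous fun L' : ℝ => ‖a y - a x‖ ^ 2 + μ * L' * ‖y - x‖ ^ 2 := by fun_prop
    have h₂ : Continuous fun L' : ℝ => (L' + μ) * inner ℝ (a y - a x) (y - x) := by fun_prop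
    have hs := hstrict x hx y hy
    rw [max_eq_left hμL] at hs
    exact le_of_tendsto_of_tendsto ((h₁.tendsto L).mono_left nhdsWithin_le_nhds)
      ((h₂.tendsto L).mono_left nhdsWithin_le_nhds)
      (eventually_of_mem (self_mem_nhdsWithin (s := Ioi L)) hs)
  have hcont : ContinuousOn a (closedBall c ε) := by
    have : LipschitzOnWith ⟨L, hL.le⟩ a (closedBall c ε) :=
      LipschitzOnWith.of_dist_le_mul fun x hx y hy => by
        rw [dist_eq_norm, dist_eq_norm]
        exact hlip y hy x hx
    exact this.continuousOn
  have hcl : closure (ball c ε ×ˢ ball c ε) = closedBall c ε ×ˢ closedBall c ε := by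
    rw [closure_prod_eq, closure_ball c hε.ne']
  have h₁ : ContinuousOn (fun p : Y × Y => a p.1) (closedBall c ε ×ˢ closedBall c ε) :=
    hcont.comp continuousOn_fst fun p hp => hp.1
  have h₂ : ContinuousOn (fun p : Y × Y => a p.2) (closedBall c ε ×ˢ closedBall c ε) :=
    hcont.comp continuousOn_snd fun p hp => hp.2
  have hmem : (x, y) ∈ closure (ball c ε ×ˢ ball c ε) := by
    rw [hcl]
    exact ⟨hx, hy⟩
  refine le_on_closure (s := ball c ε ×ˢ ball c ε)
    (f := fun p : Y × Y => ‖a p.2 - a p.1‖ ^ 2 + μ * L * ‖p.2 - p.1‖ ^ 2)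
    (g := fun p : Y × Y => (L + μ) * inner ℝ (a p.2 - a p.1) (p.2 - p.1))
    (fun p hp => hball _ hp.1 _ hp.2) ?_ ?_ hmem
  · rw [hcl]
    exact ((h₂.sub h₁).norm.pow 2).add (by fun_prop)
  · rw [hcl]
    exact continuousOn_const.mul ((h₂.sub h₁).inner (by fun_prop))

end Gradient

/-! ### Differentiability of solutions along a path of problems -/

section Path

variable {Y : Type*} [NormedAddCommGroup Y] [InnerProductSpace ℝ Y]

theorem SplitBounds.eq_of_mem {M : Set (Y × Y)} (hM : IsMonotoneGraph M) {a φ : Y → Y}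
    {D : Set Y} {c L l : ℝ} (hb : SplitBounds a φ D c L l) (hc : 0 < c) (hL : 0 ≤ L) (hl1 : l ≤ 1)
    {x y : Y} (hx : x ∈ D) (hy : y ∈ D) (hxM : (x - φ x, -a x) ∈ M) (hyM : (y - φ y, -a y) ∈ M) :
    y = x := by
  have h := hb.norm_sub_le hM hc hL hl1 hx hy hxM hyM
  simpa [sub_eq_zero] using h

theorem IsMonotoneGraph.resolvent_unique {M : Set (Y × Y)} (hM : IsMonotoneGraph M) {q x y : Y}
    (hx : (x, q - x) ∈ M) (hy : (y, q - y) ∈ M) : x = y := by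
  have h := hM _ hy _ hx
  have e : q - x - (q - y) = -(x - y) := by abel
  simp only [e, inner_neg_right, real_inner_self_eq_norm_sq] at h
  have : ‖x - y‖ ^ 2 = 0 := le_antisymm (by linarith) (sq_nonneg _)
  simpa [sub_eq_zero] using this

theorem SplitBounds.of_tendsto {ι : Type*} {F : Filter ι} [F.NeBot] {a φ : ι → Y → Y}
    {a' φ' : Y → Y} {c L l : ℝ} (ha : ∀ x, Tendsto (fun t => a t x) F (𝓝 (a' x)))
    (hφ : ∀ x, Tendsto (fun t => φ t x) F (𝓝 (φ' x)))
    (hb : ∀ x y, ∀ᶠ t in F, ∃ D, x ∈ D ∧ y ∈ D ∧ SplitBounds (a t) (φ t) D c L l) :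
    SplitBounds a' φ' univ c L l := by
  refine ⟨fun x _ y _ => ?_, fun x _ y _ => ?_, fun x _ y _ => ?_⟩
  · refine le_of_tendsto ((ha y).sub (ha x)).norm ?_
    filter_upwards [hb x y] with t ⟨D, hx, hy, h⟩ using h.lip x hx y hy
  · refine le_of_tendsto ((hφ y).sub (hφ x)).norm ?_
    filter_upwards [hb x y] with t ⟨D, hx, hy, h⟩ using h.contr x hx y hy
  · refine ge_of_tendsto (((ha y).sub (ha x)).inner
      (((hφ y).const_sub y).sub ((hφ x).const_sub x))) ?_
    filter_upwards [hb x y] with t ⟨D, hx, hy, h⟩ using h.mono x hx y hy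

/-- The bounds are invariant under passing to difference quotients. -/
theorem SplitBounds.diffQuotient {a φ : Y → Y} {D : Set Y} {c L l : ℝ}
    (hb : SplitBounds a φ D c L l) {t : ℝ} (ht : 0 < t) (x a₀ φ₀ : Y) :
    SplitBounds (fun δ => t⁻¹ • (a (x + t • δ) - a₀)) (fun δ => t⁻¹ • (φ (x + t • δ) - φ₀))
      {δ | x + t • δ ∈ D} c L l := by
  have ht' : 0 ≤ t⁻¹ := (inv_pos.2 ht).le
  have hq : ∀ (f : Y → Y) (f₀ δ δ' : Y), t⁻¹ • (f (x + t • δ') - f₀) - t⁻¹ • (f (x + t • δ) - f₀) =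
      t⁻¹ • (f (x + t • δ') - f (x + t • δ)) := by
    intro f f₀ δ δ'
    rw [← smul_sub, sub_sub_sub_cancel_right]
  have hd : ∀ δ δ' : Y, δ' - δ = t⁻¹ • ((x + t • δ') - (x + t • δ)) := by
    intro δ δ'
    rw [add_sub_add_left_eq_sub, ← smul_sub, smul_smul, inv_mul_cancel₀ ht.ne', one_smul]
  have hn : ∀ v : Y, ‖t⁻¹ • v‖ = t⁻¹ * ‖v‖ := fun v => by
    rw [norm_smul, Real.norm_of_nonneg ht']
  refine ⟨fun δ hδ δ' hδ' => ?_, fun δ hδ δ' hδ' => ?_, fun δ hδ δ' hδ' => ?_⟩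
  · rw [hq, hd δ δ', hn, hn]
    have := mul_le_mul_of_nonneg_left (hb.lip _ hδ _ hδ') ht'
    linarith
  · rw [hq, hd δ δ', hn, hn]
    have := mul_le_mul_of_nonneg_left (hb.contr _ hδ _ hδ') ht'
    linarith
  · rw [sub_sub_sub_comm, hq, hq, hd, hn, ← smul_sub, inner_smul_left, inner_smul_right,
      conj_trivial, ← sub_sub_sub_comm]
    have := mul_le_mul_of_nonneg_left (hb.mono _ hδ _ hδ') (mul_nonneg ht' ht')
    linarith

theorem tendsto_of_tendsto_diffQuotient {f : ℝ → Y} {f₀ v : Y}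
    (h : Tendsto (fun t : ℝ => t⁻¹ • (f t - f₀)) (𝓝[>] 0) (𝓝 v)) :
    Tendsto f (𝓝[>] 0) (𝓝 f₀) := by
  have h₀ : Tendsto (fun t : ℝ => t) (𝓝[>] 0) (𝓝 0) := nhdsWithin_le_nhds
  have h₁ := (h₀.smul h).add_const f₀
  rw [zero_smul, zero_add] at h₁
  refine h₁.congr' ?_
  filter_upwards [self_mem_nhdsWithin] with t ht
  rw [smul_smul, mul_inv_cancel₀ (ne_of_gt ht), one_smul, sub_add_cancel]

/-- The graph `{(j k, k - j k)}` inherits maximal monotonicity from the graphs `M t`, if `j` is the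
directional derivative of their resolvents. -/
theorem isMaximallyMonotoneGraph_derivative {M : ℝ → Set (Y × Y)} {J : ℝ → Y → Y} {j : Y → Y}
    {q₀ z₀ : Y} (hM : ∀ᶠ t in 𝓝[>] 0, IsMonotoneGraph (M t))
    (hJ : ∀ᶠ t in 𝓝[>] 0, ∀ q, (J t q, q - J t q) ∈ M t)
    (hj : ∀ k, Tendsto (fun t : ℝ => t⁻¹ • (J t (q₀ + t • k) - z₀)) (𝓝[>] 0) (𝓝 (j k))) :
    IsMaximallyMonotoneGraph {p : Y × Y | p.1 = j (p.1 + p.2)} := by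
  refine IsMonotoneGraph.isMaximallyMonotoneGraph ?_ fun q => ⟨j q, ?_⟩
  swap
  · change j q = j (j q + (q - j q))
    rw [add_sub_cancel]
  have key : ∀ k k', 0 ≤ inner ℝ (j k' - j k) ((k' - j k') - (k - j k)) := by
    intro k k'
    refine ge_of_tendsto (((hj k').sub (hj k)).inner
      (((hj k').const_sub k').sub ((hj k).const_sub k))) ?_
    filter_upwards [hM, hJ, self_mem_nhdsWithin] with t h₁ h₂ (ht : 0 < t)
    have h := h₁ _ (h₂ (q₀ + t • k)) _ (h₂ (q₀ + t • k'))
    have e₁ : t⁻¹ • (J t (q₀ + t • k') - z₀) - t⁻¹ • (J t (q₀ + t • k) - z₀) =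
        t⁻¹ • (J t (q₀ + t • k') - J t (q₀ + t • k)) := by
      rw [← smul_sub, sub_sub_sub_cancel_right]
    have e₂ : k' - t⁻¹ • (J t (q₀ + t • k') - z₀) - (k - t⁻¹ • (J t (q₀ + t • k) - z₀)) =
        t⁻¹ • (q₀ + t • k' - J t (q₀ + t • k') - (q₀ + t • k - J t (q₀ + t • k))) := by
      rw [sub_sub_sub_comm, e₁, sub_sub_sub_comm (q₀ + t • k'), add_sub_add_left_eq_sub,
        ← smul_sub, smul_sub t⁻¹ (t • _), smul_smul, inv_mul_cancel₀ ht.ne', one_smul]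
    rw [e₁, e₂, inner_smul_left, inner_smul_right, conj_trivial]
    have ht' : 0 ≤ t⁻¹ := (inv_pos.2 ht).le
    exact mul_nonneg ht' (mul_nonneg ht' h)
  intro p hp r hr
  have h := key (p.1 + p.2) (r.1 + r.2)
  have hp' : p.1 = j (p.1 + p.2) := hp
  have hr' : r.1 = j (r.1 + r.2) := hr
  rw [← hp', ← hr'] at h
  simpa using h

/-- The solution `δ` of the linearized equation exists since the hypotheses survive the passage to
directional derivatives. Then `y₀ + t δ` solves the problem at `t` up to a residual of order `o(t)`,
and stability turns this into `y t = y₀ + t δ + o(t)`. -/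
theorem exists_differentiable_solution_path [CompleteSpace Y] {a φ J : ℝ → Y → Y}
    {M : ℝ → Set (Y × Y)} {a' φ' j : Y → Y} {y₀ : Y} {ε c L l τ : ℝ} (hτ : 0 < τ) (hε : 0 < ε)
    (hc : 0 < c) (hL : 0 ≤ L) (hl0 : 0 ≤ l) (hl1 : l < 1)
    (hb : ∀ t ∈ Icc 0 τ, SplitBounds (a t) (φ t) (closedBall y₀ ε) c L l)
    (hM : ∀ t ∈ Icc 0 τ, IsMaximallyMonotoneGraph (M t))
    (hJ : ∀ t ∈ Icc 0 τ, ∀ q, (J t q, q - J t q) ∈ M t)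
    (h0 : (y₀ - φ 0 y₀, -a 0 y₀) ∈ M 0)
    (ha : ∀ δ, Tendsto (fun t : ℝ => t⁻¹ • (a t (y₀ + t • δ) - a 0 y₀)) (𝓝[>] 0) (𝓝 (a' δ)))
    (hφ : ∀ δ, Tendsto (fun t : ℝ => t⁻¹ • (φ t (y₀ + t • δ) - φ 0 y₀)) (𝓝[>] 0) (𝓝 (φ' δ)))
    (hj : ∀ k, Tendsto (fun t : ℝ => t⁻¹ • (J t (y₀ - φ 0 y₀ - a 0 y₀ + t • k) - (y₀ - φ 0 y₀)))
      (𝓝[>] 0) (𝓝 (j k))) :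
    ∃ t₀ ∈ Ioc 0 τ, ∃ y : ℝ → Y,
      (∀ t ∈ Icc 0 t₀,
        (y t ∈ closedBall y₀ ε ∧ (y t - φ t (y t), -a t (y t)) ∈ M t) ∧
        ∀ x ∈ closedBall y₀ ε, (x - φ t x, -a t x) ∈ M t → x = y t) ∧
      ∃ δ, Tendsto (fun t : ℝ => t⁻¹ • (y t - y₀)) (𝓝[>] 0) (𝓝 δ) ∧
        δ - φ' δ = j (δ - φ' δ - a' δ) ∧
        ∀ δ', δ' - φ' δ' = j (δ' - φ' δ' - a' δ') → δ' = δ := by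
  have hl : 0 < 1 - l := sub_pos.2 hl1
  have hmem : ∀ᶠ t : ℝ in 𝓝[>] 0, t ∈ Icc 0 τ := by
    filter_upwards [Ioc_mem_nhdsGT hτ] with t ht using Ioc_subset_Icc_self ht
  have hball : ∀ δ, ∀ᶠ t : ℝ in 𝓝[>] 0, y₀ + t • δ ∈ closedBall y₀ ε := by
    intro δ
    have hcts : Continuous fun t : ℝ => y₀ + t • δ := by fun_prop
    have h : Tendsto (fun t : ℝ => y₀ + t • δ) (𝓝[>] 0) (𝓝 y₀) := by
      have := (hcts.tendsto 0).mono_left (nhdsWithin_le_nhds (s := Ioi 0))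
      simpa using this
    exact h.eventually (closedBall_mem_nhds y₀ hε)
  -- solvability of the linearized equation
  have hb' : SplitBounds a' φ' univ c L l := by
    refine SplitBounds.of_tendsto ha hφ fun δ δ' => ?_
    filter_upwards [hmem, hball δ, hball δ', self_mem_nhdsWithin] with t ht h₁ h₂ (hpos : 0 < t)
    exact ⟨_, h₁, h₂, (hb t ht).diffQuotient hpos y₀ (a 0 y₀) (φ 0 y₀)⟩
  have hN : IsMaximallyMonotoneGraph {p : Y × Y | p.1 = j (p.1 + p.2)} :=
    isMaximallyMonotoneGraph_derivative (hmem.mono fun t ht => (hM t ht).mono)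
      (hmem.mono fun t ht => hJ t ht) hj
  have hNiff : ∀ δ, (δ - φ' δ, -a' δ) ∈ {p : Y × Y | p.1 = j (p.1 + p.2)} ↔
      δ - φ' δ = j (δ - φ' δ - a' δ) := fun δ => by
    rw [mem_ofPred_eq, ← sub_eq_add_neg]
  obtain ⟨δ, hδ⟩ : ∃ δ, (δ - φ' δ, -a' δ) ∈ {p : Y × Y | p.1 = j (p.1 + p.2)} := by
    have hz : (j 0, -j 0) ∈ {p : Y × Y | p.1 = j (p.1 + p.2)} := by simp
    set d := ‖j 0 - (0 - φ' 0)‖ with hd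
    set e := ‖a' 0 + -j 0‖ + L / (1 - l) * d with he
    have hd0 : 0 ≤ d := norm_nonneg _
    have he0 : 0 ≤ e := by positivity
    -- the bounds hold globally, so any residual is admissible on a large enough ball
    have hr₁ : (1 - l) * (2 * d / (1 - l) + 16 * e / (c * (1 - l))) / 2 = d + 8 * e / c := by
      field_simp
      ring
    have hr₂ : c * (1 - l) * (2 * d / (1 - l) + 16 * e / (c * (1 - l))) / 16 = c * d / 8 + e := by
      field_simp
      ring
    obtain ⟨δ, -, hδ⟩ := SplitBounds.exists_solution hN (y₀ := 0)
      (r := 2 * d / (1 - l) + 16 * e / (c * (1 - l)))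
      ⟨fun x _ y _ => hb'.lip x (mem_univ _) y (mem_univ _),
        fun x _ y _ => hb'.contr x (mem_univ _) y (mem_univ _),
        fun x _ y _ => hb'.mono x (mem_univ _) y (mem_univ _)⟩ hz (by positivity) hc hL hl0 hl1
      (by rw [hr₁, ← hd]; exact le_add_of_nonneg_right (by positivity))
      (by rw [hr₂, ← hd, ← he]; exact le_add_of_nonneg_left (by positivity))
    exact ⟨δ, hδ⟩
  -- solvability for small parameters
  have hex : ∀ᶠ t : ℝ in 𝓝[>] 0, ∃ y ∈ closedBall y₀ ε, (y - φ t y, -a t y) ∈ M t := by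
    have la := tendsto_of_tendsto_diffQuotient (ha 0)
    have lφ := tendsto_of_tendsto_diffQuotient (hφ 0)
    have lj := tendsto_of_tendsto_diffQuotient (hj 0)
    simp only [smul_zero, add_zero] at la lφ lj
    have l₁ : Tendsto (fun t => ‖J t (y₀ - φ 0 y₀ - a 0 y₀) - (y₀ - φ t y₀)‖) (𝓝[>] 0) (𝓝 0) := by
      have := (lj.sub (lφ.const_sub y₀)).norm
      simpa using this
    have l₂ : Tendsto (fun t => ‖a t y₀ + (y₀ - φ 0 y₀ - a 0 y₀ - J t (y₀ - φ 0 y₀ - a 0 y₀))‖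
        + L / (1 - l) * ‖J t (y₀ - φ 0 y₀ - a 0 y₀) - (y₀ - φ t y₀)‖) (𝓝[>] 0) (𝓝 0) := by
      have := ((la.add (lj.const_sub (y₀ - φ 0 y₀ - a 0 y₀))).norm).add (l₁.const_mul (L / (1 - l)))
      simpa using this
    filter_upwards [hmem, l₁.eventually_le_const (show 0 < (1 - l) * ε / 2 by positivity),
      l₂.eventually_le_const (show 0 < c * (1 - l) * ε / 16 by positivity)] with t ht h₁ h₂
    exact (hb t ht).exists_solution (hM t ht) (hJ t ht _) hε.le hc hL hl0 hl1 h₁ h₂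
  obtain ⟨t₁, ht₁, hex⟩ := mem_nhdsGT_iff_exists_Ioc_subset.1 hex
  have ht₁' : 0 < t₁ := ht₁
  have hex' : ∀ t, ∃ y, t ∈ Icc 0 (min t₁ τ) →
      y ∈ closedBall y₀ ε ∧ (y - φ t y, -a t y) ∈ M t := by
    intro t
    by_cases ht : t ∈ Icc 0 (min t₁ τ)
    · rcases ht.1.eq_or_lt with h | h
      · subst h
        exact ⟨y₀, fun _ => ⟨mem_closedBall_self hε.le, h0⟩⟩
      · obtain ⟨y, hy⟩ := hex ⟨h, ht.2.trans (min_le_left _ _)⟩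
        exact ⟨y, fun _ => hy⟩
    · exact ⟨0, fun h => absurd h ht⟩
  choose y hy using hex'
  have hIcc : ∀ t ∈ Icc 0 (min t₁ τ), t ∈ Icc 0 τ := fun t ht =>
    ⟨ht.1, ht.2.trans (min_le_right _ _)⟩
  refine ⟨min t₁ τ, ⟨lt_min ht₁' hτ, min_le_right _ _⟩, y, fun t ht => ⟨hy t ht, fun x hx hxM => ?_⟩,
    δ, ?_, (hNiff δ).1 hδ, fun δ' hδ' => ?_⟩
  · have ht' := hIcc t ht
    exact (hb t ht').eq_of_mem (hM t ht').mono hc hL hl1.le (hy t ht).1 hx (hy t ht).2 hxM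
  swap
  · exact hb'.eq_of_mem hN.mono hc hL hl1.le (mem_univ _) (mem_univ _) hδ ((hNiff δ').2 hδ')
  rw [hNiff] at hδ
  set k := δ - φ' δ - a' δ with hk
  have m₁ : Tendsto (fun t : ℝ => t⁻¹ • (J t (y₀ - φ 0 y₀ - a 0 y₀ + t • k) - (y₀ - φ 0 y₀))
      - (δ - t⁻¹ • (φ t (y₀ + t • δ) - φ 0 y₀))) (𝓝[>] 0) (𝓝 0) := by
    have := (hj k).sub ((hφ δ).const_sub δ)
    rwa [← hδ, sub_self] at this
  have m₂ : Tendsto (fun t : ℝ => t⁻¹ • (a t (y₀ + t • δ) - a 0 y₀) + (k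
      - t⁻¹ • (J t (y₀ - φ 0 y₀ - a 0 y₀ + t • k) - (y₀ - φ 0 y₀)))) (𝓝[>] 0) (𝓝 0) := by
    have := (ha δ).add ((hj k).const_sub k)
    rw [← hδ] at this
    convert this using 2
    rw [hk]
    abel
  have m := ((m₁.norm.add m₂.norm).const_mul ((3 + L) / c + 1))
  rw [norm_zero, add_zero, mul_zero] at m
  refine tendsto_iff_norm_sub_tendsto_zero.2 (squeeze_zero' (Eventually.of_forall fun _ =>
    norm_nonneg _) ?_ m)
  filter_upwards [hball δ, Ioc_mem_nhdsGT (lt_min ht₁' hτ)] with t hbt ht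
  have hpos : 0 < t := ht.1
  have htI : t ∈ Icc 0 (min t₁ τ) := Ioc_subset_Icc_self ht
  have ht' := hIcc t htI
  have h := (hb t ht').norm_sub_le (hM t ht').mono hc hL hl1.le (hy t htI).1 hbt (hy t htI).2
    (hJ t ht' (y₀ - φ 0 y₀ - a 0 y₀ + t • k))
  have hinv : ∀ v : Y, t⁻¹ • t • v = v := fun v => by
    rw [smul_smul, inv_mul_cancel₀ hpos.ne', one_smul]
  have hn : ∀ v : Y, ‖t⁻¹ • v‖ = t⁻¹ * ‖v‖ := fun v => by
    rw [norm_smul, Real.norm_of_nonneg (inv_pos.2 hpos).le]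
  have e₀ : t⁻¹ • (y t - y₀) - δ = -(t⁻¹ • (y₀ + t • δ - y t)) := by
    simp only [smul_sub, smul_add, hinv]
    abel
  have e₁ : t⁻¹ • (J t (y₀ - φ 0 y₀ - a 0 y₀ + t • k) - (y₀ - φ 0 y₀))
      - (δ - t⁻¹ • (φ t (y₀ + t • δ) - φ 0 y₀)) =
      t⁻¹ • (J t (y₀ - φ 0 y₀ - a 0 y₀ + t • k) - (y₀ + t • δ - φ t (y₀ + t • δ))) := by
    simp only [smul_sub, smul_add, hinv]
    abel
  have e₂ : t⁻¹ • (a t (y₀ + t • δ) - a 0 y₀) + (k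
      - t⁻¹ • (J t (y₀ - φ 0 y₀ - a 0 y₀ + t • k) - (y₀ - φ 0 y₀))) =
      t⁻¹ • (a t (y₀ + t • δ) + (y₀ - φ 0 y₀ - a 0 y₀ + t • k
        - J t (y₀ - φ 0 y₀ - a 0 y₀ + t • k))) := by
    simp only [smul_sub, smul_add, hinv]
    abel
  rw [e₀, e₁, e₂, norm_neg, hn, hn, hn]
  have := mul_le_mul_of_nonneg_left h (inv_pos.2 hpos).le
  linarith

end Path

/-! ### Identification of the dual space with `Y` -/

section Riesz

variable {Y : Type*} [NormedAddCommGroup Y] [InnerProductSpace ℝ Y] [CompleteSpace Y]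

/-- The graph of `R⁻¹ ∘ T` for a set-valued map `T : Y ⇉ Y⋆`, with the Riesz map `R`. -/
def rieszGraph (T : Y → Set (StrongDual ℝ Y)) : Set (Y × Y) :=
  {p | riesz Y p.2 ∈ T p.1}

theorem inner_riesz_symm (ξ : StrongDual ℝ Y) (v : Y) :
    inner ℝ ((riesz Y).symm ξ) v = ξ v :=
  InnerProductSpace.toDual_symm_apply

theorem IsMaximallyMonotone.isMaximallyMonotoneGraph {T : Y → Set (StrongDual ℝ Y)}
    (hT : IsMaximallyMonotone T) : IsMaximallyMonotoneGraph (rieszGraph T) := by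
  have happ : ∀ x y v : Y, (riesz Y x - riesz Y y) v = inner ℝ v (x - y) := by
    intro x y v
    rw [← map_sub, real_inner_comm]
    exact InnerProductSpace.toDual_apply_apply
  refine ⟨fun p hp q hq => ?_, fun p hp => ?_⟩
  · have h := hT.prop _ _ _ hp _ hq
    rwa [happ] at h
  · have hmono : IsMonotoneOperator fun y => T y ∪ {ξ | y = p.1 ∧ ξ = riesz Y p.2} := by
      have hrel : ∀ y, ∀ ξ ∈ T y, 0 ≤ inner ℝ (y - p.1) ((riesz Y).symm ξ - p.2) := by
        intro y ξ hξ
        refine hp (y, (riesz Y).symm ξ) ?_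
        change riesz Y ((riesz Y).symm ξ) ∈ T y
        rwa [LinearIsometryEquiv.apply_symm_apply]
      have hval : ∀ y ξ, (ξ - riesz Y p.2) (y - p.1) =
          inner ℝ (y - p.1) ((riesz Y).symm ξ - p.2) := by
        intro y ξ
        rw [← happ, LinearIsometryEquiv.apply_symm_apply]
      rintro y₁ y₂ ξ₁ (h₁ | ⟨rfl, rfl⟩) ξ₂ (h₂ | ⟨rfl, rfl⟩)
      · exact hT.prop _ _ _ h₁ _ h₂
      · rw [← neg_sub ξ₁, ← neg_sub y₁, map_neg, neg_apply, neg_neg, hval]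
        exact hrel _ _ h₁
      · rw [hval]
        exact hrel _ _ h₂
      · simp
    exact hT.le_of_ge hmono (fun y ξ h => Or.inl h) p.1 (Or.inr ⟨rfl, rfl⟩)

variable {U : Type*}

theorem solvesQGE_iff (A : Y × U → StrongDual ℝ Y) (B : Y × U → Set (StrongDual ℝ Y))
    (Φ : Y × U → Y) (u : U) (y : Y) :
    SolvesQGE A B Φ u y ↔
      (y - Φ (y, u), -(riesz Y).symm (A (y, u))) ∈ rieszGraph fun y => B (y, u) := by
  have e : riesz Y (-(riesz Y).symm (A (y, u))) = -A (y, u) := by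
    rw [map_neg, LinearIsometryEquiv.apply_symm_apply]
  unfold SolvesQGE rieszGraph
  rw [mem_ofPred_eq]
  simp only [e, singleton_add, mem_image]
  constructor
  · rintro ⟨ξ, hξ, h⟩
    rwa [← eq_neg_of_add_eq_zero_right h]
  · intro h
    exact ⟨_, h, add_neg_cancel _⟩

/-- By Minty's theorem, the resolvent map does not take its default value. -/
theorem resolventMap_mem [NormedAddCommGroup U] [NormedSpace ℝ U]
    {B : Y × U → Set (StrongDual ℝ Y)} {u : U}
    (hB : IsMaximallyMonotone fun y => B (y, u)) (q : Y) :
    (resolventMap B (q, u), q - resolventMap B (q, u)) ∈ rieszGraph fun y => B (y, u) := by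
  have hiff : ∀ y, 0 ∈ {riesz Y (y - q)} + B (y, u) ↔
      (y, q - y) ∈ rieszGraph fun y => B (y, u) := by
    intro y
    have e : riesz Y (q - y) = -riesz Y (y - q) := by rw [← map_neg, neg_sub]
    unfold rieszGraph
    rw [mem_ofPred_eq]
    simp only [e, singleton_add, mem_image]
    constructor
    · rintro ⟨ξ, hξ, h⟩
      rwa [← eq_neg_of_add_eq_zero_right h]
    · intro h
      exact ⟨_, h, add_neg_cancel _⟩
  have hex : ∃ y, 0 ∈ {riesz Y (y - q)} + B (y, u) := by
    obtain ⟨y, hy⟩ := hB.isMaximallyMonotoneGraph.exists_resolvent one_pos q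
    rw [inv_one, one_smul] at hy
    exact ⟨y, (hiff y).2 hy⟩
  rw [← hiff, resolventMap, dif_pos hex]
  exact hex.choose_spec

/-- The linearized equation as a fixed point equation: the witness `k` in the definition of the
linearized operator is determined by `δ`. -/
theorem solvesLinearizedQGE_iff [NormedAddCommGroup U] [NormedSpace ℝ U]
    (A : Y × U → StrongDual ℝ Y) (B : Y × U → Set (StrongDual ℝ Y)) (Φ : Y × U → Y)
    (y : Y) (u h : U) (δ : Y) :
    SolvesLinearizedQGE A B Φ y u h δ ↔
      δ - dirDeriv Φ (y, u) (δ, h) =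
        dirDeriv (resolventMap B) (y - Φ (y, u) - (riesz Y).symm (A (y, u)), u)
          (δ - dirDeriv Φ (y, u) (δ, h) - (riesz Y).symm (dirDeriv A (y, u) (δ, h)), h) := by
  unfold SolvesLinearizedQGE linearizedOperator
  simp only [singleton_add, mem_image, mem_ofPred_eq, map_neg, ← sub_eq_add_neg]
  constructor
  · rintro ⟨η, ⟨k, hk, rfl⟩, h₀⟩
    have h' : (riesz Y).symm (dirDeriv A (y, u) (δ, h)) +
        (k - (δ - dirDeriv Φ (y, u) (δ, h))) = 0 := by
      have := congrArg (riesz Y).symm h₀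
      rwa [map_add, LinearIsometryEquiv.symm_apply_apply, map_zero] at this
    have hk' : k = δ - dirDeriv Φ (y, u) (δ, h) - (riesz Y).symm (dirDeriv A (y, u) (δ, h)) := by
      rw [eq_sub_iff_add_eq, ← sub_eq_zero, ← h']
      abel
    rwa [← hk']
  · intro hδ
    refine ⟨_, ⟨_, hδ, rfl⟩, ?_⟩
    rw [sub_right_comm, sub_self, zero_sub, map_neg, LinearIsometryEquiv.apply_symm_apply,
      add_neg_cancel]

theorem DirDifferentiableAt.tendsto {X E : Type*} [NormedAddCommGroup X] [NormedSpace ℝ X]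
    [NormedAddCommGroup E] [NormedSpace ℝ E] {F : X → E} {x : X} (hF : DirDifferentiableAt F x)
    (v : X) :
    Tendsto (fun t : ℝ => t⁻¹ • (F (x + t • v) - F x)) (𝓝[>] 0) (𝓝 (dirDeriv F x v)) := by
  have h := hasDerivWithinAt_iff_tendsto_slope.1 (hF v).hasDerivWithinAt
  rw [Ici_sdiff_left] at h
  refine h.congr fun t => ?_
  simp [slope_def_module]

end Riesz

/-! ### Solutions of the parametrized equation -/

theorem mainTheorem3
    {Y : Type*} [NormedAddCommGroup Y] [InnerProductSpace ℝ Y] [CompleteSpace Y]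
    {U : Type*} [NormedAddCommGroup U] [NormedSpace ℝ U] [CompleteSpace U]
    (A : Y × U → StrongDual ℝ Y) (B : Y × U → Set (StrongDual ℝ Y)) (Φ : Y × U → Y)
    (yStar : Y) (uStar : U) (𝒰 : Set U) (h𝒰 : 𝒰 ∈ 𝓝 uStar)
    (ε μA LA LΦ : ℝ) (hε : 0 < ε) (hμA : 0 < μA) (hLA : 0 < LA)
    -- local strong monotonicity and Lipschitz continuity of `A`, uniformly in `u ∈ 𝒰`
    (hAmono : ∀ u ∈ 𝒰, ∀ y₁ ∈ closedBall yStar ε, ∀ y₂ ∈ closedBall yStar ε,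
      μA * ‖y₂ - y₁‖ ^ 2 ≤ (A (y₂, u) - A (y₁, u)) (y₂ - y₁))
    (hAlip : ∀ u ∈ 𝒰, ∀ y₁ ∈ closedBall yStar ε, ∀ y₂ ∈ closedBall yStar ε,
      ‖A (y₂, u) - A (y₁, u)‖ ≤ LA * ‖y₂ - y₁‖)
    (hB : ∀ u ∈ 𝒰, IsMaximallyMonotone fun y => B (y, u))
    (hsol : SolvesQGE A B Φ uStar yStar)
    -- `Φ` is continuous at the reference point and locally a uniform contraction
    (hΦcont : ContinuousAt Φ (yStar, uStar))
    (hLΦ0 : 0 ≤ LΦ) (hLΦ1 : LΦ < 1)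
    (hΦlip : ∀ u ∈ 𝒰, ∀ y₁ ∈ closedBall yStar ε, ∀ y₂ ∈ closedBall yStar ε,
      ‖Φ (y₂, u) - Φ (y₁, u)‖ ≤ LΦ * ‖y₂ - y₁‖)
    -- smallness of `LΦ` relative to the local condition number `LA / μA`
    (hsmall : LΦ < (LA / μA)⁻¹ ∨
      (LΦ < 2 * √(LA / μA) / (1 + LA / μA) ∧
        ∃ g : Y × U → ℝ, ∀ u ∈ 𝒰, ∀ y ∈ ball yStar ε,
          HasFDerivAt (fun x : Y => g (x, u)) (A (y, u)) y))
    -- directional differentiability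
    (hAdiff : DirDifferentiableAt A (yStar, uStar))
    (hJdiff : DirDifferentiableAt (resolventMap B)
      (yStar - (riesz Y).symm (A (yStar, uStar)) - Φ (yStar, uStar), uStar))
    (hΦdiff : DirDifferentiableAt Φ (yStar, uStar))
    (h : U) :
    ∃ t₀ : ℝ, 0 < t₀ ∧ ∃ y : ℝ → Y,
      (∀ t ∈ Icc 0 t₀,
        (y t ∈ closedBall yStar ε ∧ SolvesQGE A B Φ (uStar + t • h) (y t)) ∧
        ∀ x ∈ closedBall yStar ε, SolvesQGE A B Φ (uStar + t • h) x → x = y t) ∧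
      ∃ δ : Y,
        Tendsto (fun t : ℝ => t⁻¹ • (y t - yStar)) (𝓝[>] 0) (𝓝 δ) ∧
        SolvesLinearizedQGE A B Φ yStar uStar h δ ∧
        ∀ δ' : Y, SolvesLinearizedQGE A B Φ yStar uStar h δ' → δ' = δ := by
  let a : Y × U → Y := fun p => (riesz Y).symm (A p)
  have hmono : ∀ u ∈ 𝒰, ∀ x ∈ closedBall yStar ε, ∀ y ∈ closedBall yStar ε,
      μA * ‖y - x‖ ^ 2 ≤ inner ℝ (a (y, u) - a (x, u)) (y - x) := by
    intro u hu x hx y hy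
    have := hAmono u hu x hx y hy
    rwa [← inner_riesz_symm, map_sub] at this
  have hlip : ∀ u ∈ 𝒰, ∀ x ∈ closedBall yStar ε, ∀ y ∈ closedBall yStar ε,
      ‖a (y, u) - a (x, u)‖ ≤ LA * ‖y - x‖ := by
    intro u hu x hx y hy
    have := hAlip u hu x hx y hy
    rwa [← LinearIsometryEquiv.norm_map (riesz Y).symm, map_sub] at this
  obtain ⟨c, hc, hb⟩ : ∃ c > 0, ∀ u ∈ 𝒰, SplitBounds (fun y => a (y, u)) (fun y => Φ (y, u))
      (closedBall yStar ε) c LA LΦ := by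
    rcases hsmall with hs | ⟨hs, g, hg⟩
    · refine ⟨μA - LA * LΦ, ?_, fun u hu => SplitBounds.of_small_lipschitz hLA.le (hmono u hu)
        (hlip u hu) (hΦlip u hu)⟩
      rw [inv_div, lt_div_iff₀ hLA] at hs
      linarith
    · refine ⟨μA * LA / (LA + μA) - (LA + μA) * LΦ ^ 2 / 4, ?_, fun u hu =>
        SplitBounds.of_cocoercive hμA hLA (fun x hx y hy => ?_) (hlip u hu) (hΦlip u hu)⟩
      · have hs₂ := pow_lt_pow_left₀ hs hLΦ0 two_ne_zero
        have e : (2 * √(LA / μA) / (1 + LA / μA)) ^ 2 = 4 * (μA * LA) / (LA + μA) ^ 2 := by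
          rw [div_pow, mul_pow, Real.sq_sqrt (by positivity)]
          field_simp
          ring
        rw [e, lt_div_iff₀ (by positivity)] at hs₂
        have hP : 0 < LA + μA := by positivity
        rw [gt_iff_lt, sub_pos, lt_div_iff₀ hP]
        linarith
      · refine gradient_strong_cocoercive (g := fun x => g (x, u)) (a := fun y => a (y, u)) hε hμA
          hLA (fun z hz => ?_) (hmono u hu) (hlip u hu) hx hy
        rw [hasGradientAt_iff_hasFDerivAt]
        have := hg u hu z hz
        rwa [← LinearIsometryEquiv.apply_symm_apply (riesz Y) (A (z, u))] at this
  -- parameters along the ray stay in `𝒰`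
  obtain ⟨τ, hτ, hτ𝒰⟩ : ∃ τ > 0, ∀ t ∈ Icc (0 : ℝ) τ, uStar + t • h ∈ 𝒰 := by
    have hcts : Continuous fun t : ℝ => uStar + t • h := by fun_prop
    have h₁ : (fun t : ℝ => uStar + t • h) ⁻¹' 𝒰 ∈ 𝓝 (0 : ℝ) :=
      hcts.continuousAt.preimage_mem_nhds (by simpa using h𝒰)
    obtain ⟨τ, hτ, hsub⟩ := Metric.nhds_basis_closedBall.mem_iff.1 h₁
    refine ⟨τ, hτ, fun t ht => hsub ?_⟩
    rw [Real.closedBall_eq_Icc]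
    exact ⟨by linarith [ht.1], by linarith [ht.2]⟩
  have hu₀ : uStar ∈ 𝒰 := mem_of_mem_nhds h𝒰
  have hq : yStar - (riesz Y).symm (A (yStar, uStar)) - Φ (yStar, uStar) =
      yStar - Φ (yStar, uStar) - a (yStar, uStar) := sub_right_comm _ _ _
  have hsol' := (solvesQGE_iff A B Φ uStar yStar).1 hsol
  have hJ₀ : resolventMap B (yStar - Φ (yStar, uStar) - a (yStar, uStar), uStar) =
      yStar - Φ (yStar, uStar) := by
    refine (hB _ hu₀).isMaximallyMonotoneGraph.mono.resolvent_unique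
      (resolventMap_mem (hB _ hu₀) _) ?_
    rwa [sub_right_comm, sub_self, zero_sub]
  rw [hq] at hJdiff
  obtain ⟨t₀, ht₀, y, hy, δ, hδ, hδ₁, hδ₂⟩ := exists_differentiable_solution_path
    (a := fun t y => a (y, uStar + t • h)) (φ := fun t y => Φ (y, uStar + t • h))
    (J := fun t q => resolventMap B (q, uStar + t • h))
    (M := fun t => rieszGraph fun y => B (y, uStar + t • h))
    (a' := fun δ => (riesz Y).symm (dirDeriv A (yStar, uStar) (δ, h)))
    (φ' := fun δ => dirDeriv Φ (yStar, uStar) (δ, h))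
    (j := fun k => dirDeriv (resolventMap B)
      (yStar - Φ (yStar, uStar) - a (yStar, uStar), uStar) (k, h))
    hτ hε hc hLA.le hLΦ0 hLΦ1 (fun t ht => hb _ (hτ𝒰 t ht))
    (fun t ht => (hB _ (hτ𝒰 t ht)).isMaximallyMonotoneGraph)
    (fun t ht q => resolventMap_mem (hB _ (hτ𝒰 t ht)) q)
    (by simpa using hsol')
    (fun δ => by
      have h₁ := ((riesz Y).symm.continuous.tendsto _).comp (hAdiff.tendsto (δ, h))
      refine h₁.congr fun t => ?_
      simp [a])
    (fun δ => by simpa using hΦdiff.tendsto (δ, h))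
    (fun k => by simpa [hJ₀] using hJdiff.tendsto (k, h))
  refine ⟨t₀, ht₀.1, y, fun t ht => ?_, δ, hδ, (solvesLinearizedQGE_iff ..).2 hδ₁,
    fun δ' hδ' => hδ₂ δ' ((solvesLinearizedQGE_iff ..).1 hδ')⟩
  simp only [solvesQGE_iff]
  exact hy t ht
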